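/- Definitions. An office-like polygon is a connected closed region of the plane that is the union of finitely many axis-parallel non-degenerate rectangles, called rooms, and finitely many axis-parallel non-degenerate rectangles, called corridors, such that distinct rooms are disjoint, distinct corridors are disjoint, and every corridor $C$ links exactly two rooms: two opposite sides of $C$ lie in the relative interiors of edges of these two rooms (the rooms lie to the left and to the right of $C$, or below and above $C$), and $C$ is disjoint from every other room. Holes are allowed. The vertices of the polygon $\mathcal P$ are the corners of its rooms and corridors. Two points $p,q$ of $\mathcal P$ see each other if the axis-parallel rectangle spanned by $p$ and $q$ is contained in $\mathcal P$. A vertex guard set is a set $G$ of vertices such that every point of $\mathcal P$ is seen by some $g\in G$. The dispersion distance of $G$ is the minimum, over all pairs of distinct $g,h\in G$, of the geodesic distance $\delta(g,h)$, the infimum of the $L_1$-lengths of the paths in $\mathcal P$ from $g$ to $h$ (it is $\infty$ if $G$ has fewer than two elements). Theorem. (a) Every office-like polygon (with or without holes) all of whose vertices have integer coordinates has a vertex guard set with dispersion distance at least $3$. (b) There is a polynomial-time algorithm that computes such a set: there are a program for an integer random access machine (additions, subtractions, comparisons, indirect memory access, each at unit cost) and a polynomial $p$ such that, for every office-like polygon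 with $n$ vertices, all at integer coordinates, given by the lists of its rooms and corridors, the program halts after at most $p(n)$ steps and outputs a list of the elements of a vertex guard set with dispersion distance at least $3$. (c) The bound $3$ is sometimes optimal: there is an office-like polygon with vertices at integer coordinates in which every vertex guard set has dispersion distance at most $3$. -/

import Mathlib

open scoped ENNReal

/-- A non-degenerate closed axis-parallel rectangle `[x₁, x₂] × [y₁, y₂]` with integer corners. -/
structure IntRect where
  x₁ : ℤ
  x₂ : ℤ
  y₁ : ℤ
  y₂ : ℤ
  hx : x₁ < x₂
  hy : y₁ < y₂

namespace IntRect

/-- The rectangle as a closed subset of the plane. -/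
def toSet (R : IntRect) : Set (ℝ × ℝ) :=
  Set.Icc ((R.x₁ : ℝ), (R.y₁ : ℝ)) ((R.x₂ : ℝ), (R.y₂ : ℝ))

/-- The four corners of the rectangle. -/
def corners (R : IntRect) : List (ℤ × ℤ) :=
  [(R.x₁, R.y₁), (R.x₂, R.y₁), (R.x₂, R.y₂), (R.x₁, R.y₂)]

/-- The four numbers that describe the rectangle. -/
def coords (R : IntRect) : List ℤ := [R.x₁, R.x₂, R.y₁, R.y₂]

/-- `C` is a horizontal corridor from the room `A` on its left to the room `B` on its right: the
left side of `C` lies in the relative interior of the right edge of `A`, and the right side of `C`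
lies in the relative interior of the left edge of `B`. -/
def LinksHorizontally (C A B : IntRect) : Prop :=
  (A.x₂ = C.x₁ ∧ A.y₁ < C.y₁ ∧ C.y₂ < A.y₂) ∧ (C.x₂ = B.x₁ ∧ B.y₁ < C.y₁ ∧ C.y₂ < B.y₂)

/-- `C` is a vertical corridor from the room `A` below it to the room `B` above it. -/
def LinksVertically (C A B : IntRect) : Prop :=
  (A.y₂ = C.y₁ ∧ A.x₁ < C.x₁ ∧ C.x₂ < A.x₂) ∧ (C.y₂ = B.y₁ ∧ B.x₁ < C.x₁ ∧ C.x₂ < B.x₂)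

end IntRect

/-- An office-like polygon (holes allowed) with integer vertex coordinates: a connected region
that is made up of rectangular rooms and rectangular corridors. Distinct rooms do not meet,
distinct corridors do not meet, and every corridor links exactly two rooms and meets no other. -/
structure OfficeLikePolygon where
  rooms : List IntRect
  corridors : List IntRect
  rooms_disjoint : rooms.Pairwise fun A B => Disjoint A.toSet B.toSet
  corridors_disjoint : corridors.Pairwise fun C D => Disjoint C.toSet D.toSet
  corridors_link : ∀ C ∈ corridors, ∃ A ∈ rooms, ∃ B ∈ rooms,
    (C.LinksHorizontally A B ∨ C.LinksVertically A B) ∧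
      ∀ R ∈ rooms, R ≠ A → R ≠ B → Disjoint C.toSet R.toSet
  connected : IsConnected (⋃ R ∈ rooms ++ corridors, R.toSet)

/-- The inclusion of the integer grid into the plane. -/
def gridPoint (v : ℤ × ℤ) : ℝ × ℝ := ((v.1 : ℝ), (v.2 : ℝ))

/-- The `L₁`-length of a path in the plane: its total variation with respect to the `L₁`-metric. -/
noncomputable def l1Length {p q : ℝ × ℝ} (γ : Path p q) : ℝ≥0∞ :=
  eVariationOn (fun t => WithLp.toLp 1 (γ t)) Set.univ

/-- The geodesic `L₁`-distance of `p` and `q` in the region `S`: the infimum of the `L₁`-lengths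
of the paths from `p` to `q` that stay inside `S`. -/
noncomputable def geodesicDist (S : Set (ℝ × ℝ)) (p q : ℝ × ℝ) : ℝ≥0∞ :=
  ⨅ (γ : Path p q) (_ : ∀ t, γ t ∈ S), l1Length γ

namespace OfficeLikePolygon

/-- The closed polygonal region. -/
def region (P : OfficeLikePolygon) : Set (ℝ × ℝ) :=
  ⋃ R ∈ P.rooms ++ P.corridors, R.toSet

/-- The vertices of the polygon. As every corridor is strictly narrower than the edges that it is
attached to, these are exactly the corners of the rooms (convex vertices) and the corners of the
corridors (reflex vertices). -/
def vertices (P : OfficeLikePolygon) : Finset (ℤ × ℤ) :=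
  ((P.rooms ++ P.corridors).flatMap IntRect.corners).toFinset

/-- `r`-visibility: the axis-parallel rectangle spanned by `p` and `q` lies in the polygon. -/
def Sees (P : OfficeLikePolygon) (p q : ℝ × ℝ) : Prop :=
  Set.uIcc p q ⊆ P.region

/-- A set of vertices such that every point of the polygon is seen by one of them. -/
def IsVertexGuardSet (P : OfficeLikePolygon) (G : Finset (ℤ × ℤ)) : Prop :=
  G ⊆ P.vertices ∧ ∀ p ∈ P.region, ∃ g ∈ G, P.Sees (gridPoint g) p

/-- The dispersion distance of a set of guards: the minimum of the geodesic `L₁`-distances between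
any two different guards (`∞` if there are no two different guards). -/
noncomputable def dispersion (P : OfficeLikePolygon) (G : Finset (ℤ × ℤ)) : ℝ≥0∞ :=
  ⨅ (g ∈ G) (h ∈ G) (_ : g ≠ h), geodesicDist P.region (gridPoint g) (gridPoint h)

/-- The input format: the numbers of rooms and of corridors, followed by the coordinates of the
rooms and of the corridors. -/
def encode (P : OfficeLikePolygon) : List ℤ :=
  (P.rooms.length : ℤ) :: (P.corridors.length : ℤ) ::
    (P.rooms ++ P.corridors).flatMap IntRect.coords

end OfficeLikePolygon

/-! A random access machine over the integers, programmed in a structured language. It has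
finitely many named registers per program, an integer-addressed memory and an output tape. Its only
arithmetic operations are addition and subtraction. Every operator of an expression and every
instruction costs one step. (Without multiplication, a step at most doubles the largest absolute
value present, so a polynomial number of steps is polynomial time on a Turing machine, too.) -/

namespace RAM

/-- Integer expressions: constants, registers, memory cells with computed address, `+`, `-`. -/
inductive Expr where
  | const (z : ℤ)
  | reg (r : ℕ)
  | load (addr : Expr)
  | add (e₁ e₂ : Expr)
  | sub (e₁ e₂ : Expr)

/-- Tests. -/
inductive Test where
  | le (e₁ e₂ : Expr)
  | eq (e₁ e₂ : Expr)
  | not (b : Test)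
  | and (b₁ b₂ : Test)

/-- Programs. -/
inductive Prog where
  | skip
  | assign (r : ℕ) (e : Expr)
  | store (addr e : Expr)
  | write (e : Expr)
  | seq (A B : Prog)
  | ite (b : Test) (A B : Prog)
  | loop (b : Test) (A : Prog)

/-- A state: the registers, the memory, and the numbers written so far, in order. -/
structure State where
  regs : ℕ → ℤ
  mem : ℤ → ℤ
  out : List ℤ

/-- The initial state: the input stands in the memory cells `0, 1, 2, …`, all else is empty. -/
def State.init (input : List ℤ) : State where
  regs := fun _ => 0
  mem := fun a => if 0 ≤ a then input.getD a.toNat 0 else 0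
  out := []

/-- The value of an expression. -/
def Expr.eval (s : State) : Expr → ℤ
  | const z => z
  | reg r => s.regs r
  | load a => s.mem (a.eval s)
  | add e₁ e₂ => e₁.eval s + e₂.eval s
  | sub e₁ e₂ => e₁.eval s - e₂.eval s

/-- The number of steps for the evaluation of an expression. -/
def Expr.cost : Expr → ℕ
  | const _ => 1
  | reg _ => 1
  | load a => a.cost + 1
  | add e₁ e₂ => e₁.cost + e₂.cost + 1
  | sub e₁ e₂ => e₁.cost + e₂.cost + 1

/-- The truth of a test. -/
def Test.Holds (s : State) : Test → Prop
  | le e₁ e₂ => e₁.eval s ≤ e₂.eval s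
  | eq e₁ e₂ => e₁.eval s = e₂.eval s
  | not b => ¬ b.Holds s
  | and b₁ b₂ => b₁.Holds s ∧ b₂.Holds s

/-- The number of steps for a test. -/
def Test.cost : Test → ℕ
  | le e₁ e₂ => e₁.cost + e₂.cost + 1
  | eq e₁ e₂ => e₁.cost + e₂.cost + 1
  | not b => b.cost + 1
  | and b₁ b₂ => b₁.cost + b₂.cost + 1

/-- `Exec A s t s'`: the program `A`, started in the state `s`, halts after exactly `t` steps in
the state `s'`. -/
inductive Exec : Prog → State → ℕ → State → Prop
  | skip (s : State) : Exec .skip s 1 s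
  | assign (s : State) (r : ℕ) (e : Expr) :
      Exec (.assign r e) s (e.cost + 1) { s with regs := Function.update s.regs r (e.eval s) }
  | store (s : State) (a e : Expr) :
      Exec (.store a e) s (a.cost + e.cost + 1)
        { s with mem := Function.update s.mem (a.eval s) (e.eval s) }
  | write (s : State) (e : Expr) :
      Exec (.write e) s (e.cost + 1) { s with out := s.out ++ [e.eval s] }
  | seq {A B : Prog} {s s₁ s₂ : State} {t₁ t₂ : ℕ} :
      Exec A s t₁ s₁ → Exec B s₁ t₂ s₂ → Exec (.seq A B) s (t₁ + t₂) s₂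
  | ite_true {b : Test} {A B : Prog} {s s₁ : State} {t : ℕ} :
      b.Holds s → Exec A s t s₁ → Exec (.ite b A B) s (b.cost + t + 1) s₁
  | ite_false {b : Test} {A B : Prog} {s s₁ : State} {t : ℕ} :
      ¬ b.Holds s → Exec B s t s₁ → Exec (.ite b A B) s (b.cost + t + 1) s₁
  | loop_done {b : Test} {A : Prog} {s : State} :
      ¬ b.Holds s → Exec (.loop b A) s (b.cost + 1) s
  | loop_step {b : Test} {A : Prog} {s s₁ s₂ : State} {t₁ t₂ : ℕ} :
      b.Holds s → Exec A s t₁ s₁ → Exec (.loop b A) s₁ t₂ s₂ →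
        Exec (.loop b A) s (b.cost + t₁ + t₂ + 1) s₂

end RAM

/-- The output format: the coordinates of the points of a list, one point after the other. -/
def encodePoints (L : List (ℤ × ℤ)) : List ℤ :=
  L.flatMap fun v => [v.1, v.2]

/-! Every corridor gets a candidate guard at one of its two lower corners (vertical corridors are
treated by reflection in the diagonal). Some candidates are discarded, and every room on which no
remaining guard stands gets one at its upper right corner. Integrality is used throughout: disjoint
rectangles have distance at least one, and a corridor keeps at least one unit from the ends of the
edges to which it is attached.

Sides. Lower corners of two corridors on one wall differ in height by at least two; if by exactly
two, the corridors share both rooms (`stacked_of_hasRight`, `stacked_of_hasLeft`). The guards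
alternate sides along such a stack, so the corridor length supplies a third unit. The left side is
the default. Hence a guard at a right end has another corridor beneath it and is not near the lower
left corner of its room, the only corner at which a horizontal and a vertical corridor could have
guards at distance two (`gridDist_anchor_anchor_swap`).

Discarding. A guard on a room of width one or two may be too close to the guard of a corridor on the
opposite wall. In that case one of the two guards sees the whole corridor of the other; this is
recorded by `Overlooks`. A candidate is kept if and only if no kept one overlooks its corridor. Such
a kernel exists since the relation is acyclic (`OverlooksFrom.before`), and discarded corridors
remain seen.

Geodesics. For guards on one room the planar distance suffices. A path between different rooms
either runs through a corridor linking them, or leaves the first room by one corridor and enters the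
second by another (`exists_passage`). In the latter case crossing the first corridor, passing to the
second and crossing it cost one unit each. In the former, either a guard lies in the linking
corridor and planar distances suffice, or reaching, crossing and leaving the corridor cost one unit
each.

Algorithm. Both choices are kernels of acyclic relations on the corridors, and sweeping over an
array as often as there are corridors computes such a kernel (`Ends.kernel`).

Optimality. In `ladder`, each of three unit corridors forces a guard at one of its own corners, and
two consecutive ones among these have distance at most three. -/

/-! ### Integer rectangles, their adjacency, and the reflection that exchanges the coordinates -/

namespace IntRect

/-- Two integer rectangles are separated by a horizontal or a vertical line. -/
abbrev Sep (A B : IntRect) : Prop :=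
  A.x₂ < B.x₁ ∨ B.x₂ < A.x₁ ∨ A.y₂ < B.y₁ ∨ B.y₂ < A.y₁

/-- The left side of `C` lies in the relative interior of the right edge of `A`. -/
abbrev HasLeft (C A : IntRect) : Prop := A.x₂ = C.x₁ ∧ A.y₁ < C.y₁ ∧ C.y₂ < A.y₂

/-- The right side of `C` lies in the relative interior of the left edge of `B`. -/
abbrev HasRight (C B : IntRect) : Prop := C.x₂ = B.x₁ ∧ B.y₁ < C.y₁ ∧ C.y₂ < B.y₂

/-- Reflection in the diagonal. -/
abbrev swap (R : IntRect) : IntRect := ⟨R.y₁, R.y₂, R.x₁, R.x₂, R.hy, R.hx⟩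

/-- An integer point lies in a rectangle. -/
abbrev Contains (R : IntRect) (v : ℤ × ℤ) : Prop :=
  R.x₁ ≤ v.1 ∧ v.1 ≤ R.x₂ ∧ R.y₁ ≤ v.2 ∧ v.2 ≤ R.y₂

/-- `C` is a horizontal corridor between two rooms of the given set. -/
def IsHorizontal (rooms : Set IntRect) (C : IntRect) : Prop :=
  ∃ A ∈ rooms, ∃ B ∈ rooms, C.HasLeft A ∧ C.HasRight B ∧
    ∀ R ∈ rooms, R ≠ A → R ≠ B → C.Sep R

/-- The lower corner of a horizontal corridor at its left side (if `s` holds) or at its right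
side (otherwise). -/
noncomputable def anchor (s : Prop) (C : IntRect) : ℤ × ℤ :=
  open Classical in (if s then C.x₁ else C.x₂, C.y₁)

/-- `C` lies on top of `D`, at distance one, and `D` has height one. -/
abbrev Stacked (D C : IntRect) : Prop := D.x₁ = C.x₁ ∧ D.x₂ = C.x₂ ∧ D.y₁ + 2 = C.y₁

/-- The guard of the horizontal corridor `D` stands on a room of width at most two, and sees the
corridor `C` on the opposite side of this room. -/
abbrev Overlooks (sD sC : Prop) (D C : IntRect) : Prop :=
  (D.y₁ = C.y₁ ∨ D.y₁ = C.y₁ + 1) ∧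
    ((¬ sD ∧ (C.x₁ = D.x₂ + 1 ∨ C.x₁ = D.x₂ + 2)) ∨
      (sD ∧ (D.x₁ = C.x₂ + 1 ∨ D.x₁ = C.x₂ + 2) ∧ ¬ (¬ sC ∧ D.y₁ = C.y₁)))

theorem anchor_of {s : Prop} (h : s) (C : IntRect) : C.anchor s = (C.x₁, C.y₁) := by
  simp [anchor, h]

theorem anchor_of_not {s : Prop} (h : ¬ s) (C : IntRect) : C.anchor s = (C.x₂, C.y₁) := by
  simp [anchor, h]

end IntRect

/-- The `L₁`-distance of two points of the integer grid. -/
abbrev gridDist (p q : ℤ × ℤ) : ℕ := (p.1 - q.1).natAbs + (p.2 - q.2).natAbs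

open IntRect

/-! ### Planar distances between the guards of corridors at a common room -/

section Horizontal

variable {rooms : Set IntRect} {C D B : IntRect}

/-- This trichotomy consists of linear inequalities, so the distance estimates below reduce to
integer arithmetic. -/
theorem IntRect.IsHorizontal.meet (h : C.IsHorizontal rooms) :
    ∀ R ∈ rooms, C.Sep R ∨ C.HasLeft R ∨ C.HasRight R := by
  obtain ⟨A, -, B, -, hA, hB, h⟩ := h
  intro R hR
  by_cases h1 : R = A
  · subst h1; exact Or.inr (Or.inl hA)
  by_cases h2 : R = B
  · subst h2; exact Or.inr (Or.inr hB)
  exact Or.inl (h R hR h1 h2)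

/-- Corridors on a common wall whose lower sides have distance two share both rooms. -/
theorem stacked_of_hasRight (hC : C.IsHorizontal rooms) (hD : D.IsHorizontal rooms)
    (hCB : C.HasRight B) (hDB : D.HasRight B)
    (h : D.y₁ + 2 = C.y₁) : D.Stacked C := by
  obtain ⟨A, hA, -, -, hCA, -⟩ := id hC
  obtain ⟨A', hA', -, -, hDA', -⟩ := id hD
  have h1 := hC.meet A' hA'
  have h2 := hD.meet A hA
  have := C.hx; have := C.hy; have := D.hx; have := D.hy
  have := A.hx; have := A.hy; have := A'.hx; have := A'.hy
  omega

theorem stacked_of_hasLeft (hC : C.IsHorizontal rooms) (hD : D.IsHorizontal rooms)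
    (hCB : C.HasLeft B) (hDB : D.HasLeft B)
    (h : D.y₁ + 2 = C.y₁) : D.Stacked C := by
  obtain ⟨-, -, A, hA, -, hCA, -⟩ := id hC
  obtain ⟨-, -, A', hA', -, hDA', -⟩ := id hD
  have h1 := hC.meet A' hA'
  have h2 := hD.meet A hA
  have := C.hx; have := C.hy; have := D.hx; have := D.hy
  have := A.hx; have := A.hy; have := A'.hx; have := A'.hy
  omega

/-- Two horizontal corridors at a common room that do not overlook each other, one of them with
its guard at this room. -/
theorem gridDist_anchor_anchor {sC sD : Prop} (hC : C.IsHorizontal rooms)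
    (hD : D.IsHorizontal rooms) (hCD : D.Sep C) (hB : B ∈ rooms)
    (hDB : B.Contains (D.anchor sD)) (hCB : ¬ C.Sep B)
    (h₁ : D.Stacked C → (sC ↔ ¬ sD)) (h₂ : C.Stacked D → (sD ↔ ¬ sC))
    (h₃ : ¬ Overlooks sD sC D C) (h₄ : ¬ Overlooks sC sD C D) :
    3 ≤ gridDist (C.anchor sC) (D.anchor sD) := by
  have h5 := hC.meet B hB
  have h6 := hD.meet B hB
  have := C.hx; have := C.hy; have := D.hx; have := D.hy
  have := B.hx; have := B.hy
  have hDB' : ¬ D.Sep B := by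
    by_cases hsD : sD
    · simp only [anchor_of hsD, Contains] at hDB; omega
    · simp only [anchor_of_not hsD, Contains] at hDB; omega
  -- On a common wall the two heights differ by at least two. Equality forces a stack, whose guards
  -- are on opposite sides, and the length of the corridor gives the third unit.
  have h7 : (C.HasLeft B ∧ D.HasLeft B) ∨ (C.HasRight B ∧ D.HasRight B) →
      (D.y₁ + 2 = C.y₁ → (sC ↔ ¬ sD)) ∧ (C.y₁ + 2 = D.y₁ → (sD ↔ ¬ sC)) := by
    rintro (⟨h8, h9⟩ | ⟨h8, h9⟩)
    · exact ⟨fun h => h₁ (stacked_of_hasLeft hC hD h8 h9 h),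
        fun h => h₂ (stacked_of_hasLeft hD hC h9 h8 h)⟩
    · exact ⟨fun h => h₁ (stacked_of_hasRight hC hD h8 h9 h),
        fun h => h₂ (stacked_of_hasRight hD hC h9 h8 h)⟩
  clear h₁ h₂
  by_cases hsC : sC <;> by_cases hsD : sD <;>
    simp only [anchor_of, anchor_of_not, Overlooks, hsC, hsD, not_true_eq_false,
      not_false_eq_true, iff_true, iff_false, false_and, false_or, true_and, or_false,
      and_true, imp_false, gridDist, Contains] at h₃ h₄ h7 hDB ⊢ <;>
    rcases h5 with h5 | h5 | h5 <;> rcases h6 with h6 | h6 | h6 <;> omega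

/-- A corridor with its guard at its right side, on top of another corridor, is not the lowest one
on the left wall of its right room. -/
theorem add_two_lt_of_stacked (hrooms : rooms.Pairwise IntRect.Sep) (hD : D.IsHorizontal rooms)
    (hB : B ∈ rooms) (hCB : C.HasRight B) (h : D.Stacked C) : B.y₁ + 2 < C.y₁ := by
  have h1 := hD.meet B hB
  obtain ⟨-, -, A, hA, -, hDA, -⟩ := id hD
  have := C.hx; have := C.hy; have := D.hx; have := D.hy; have := B.hx; have := B.hy
  have := A.hx; have := A.hy
  by_cases hAB : A = B
  · subst hAB; omega
  · have := hrooms hA hB hAB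
    omega

/-- A horizontal corridor and a vertical one at a common room, one of them with its guard at this
room. -/
theorem gridDist_anchor_anchor_swap {sC sD : Prop} (hC : C.IsHorizontal rooms)
    (hD : D.swap.IsHorizontal (swap ⁻¹' rooms)) (hB : B ∈ rooms) (hCB : ¬ C.Sep B)
    (hDB : ¬ D.Sep B) (hB' : B.Contains (C.anchor sC) ∨ B.Contains (D.swap.anchor sD).swap)
    (h : ¬ sC → C.HasRight B → B.y₁ + 2 < C.y₁) :
    3 ≤ gridDist (C.anchor sC) (D.swap.anchor sD).swap := by
  have h5 := hC.meet B hB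
  have h6 := hD.meet B.swap (by simpa using hB)
  have := C.hx; have := C.hy; have := D.hx; have := D.hy
  have := B.hx; have := B.hy
  -- The critical corner is the lower left one, where both guards could be one unit away; there `h`
  -- lifts the guard of `C` by three. A guard is the lower end of a side of length at least one, so
  -- it stays two units from the upper or right end of its wall.
  by_cases hsC : sC <;> by_cases hsD : sD <;>
    simp only [anchor_of, anchor_of_not, hsC, hsD, not_true_eq_false, not_false_eq_true,
      forall_const, false_imp_iff, Prod.swap, gridDist, Contains, IntRect.Sep, HasLeft,
      HasRight] at h h6 hB' ⊢ <;>
    rcases h5 with h5 | h5 | h5 <;> rcases h6 with h6 | h6 | h6 <;> omega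

/-- The upper right corner of a room is far from a guard at the other end of a corridor. -/
theorem gridDist_corner_anchor {sC : Prop} (hC : C.IsHorizontal rooms) (hB : B ∈ rooms)
    (hCB : ¬ C.Sep B) (h : ¬ B.Contains (C.anchor sC)) :
    3 ≤ gridDist (B.x₂, B.y₂) (C.anchor sC) := by
  have h5 := hC.meet B hB
  have := C.hx; have := C.hy; have := B.hx; have := B.hy
  -- Height and margin of the corridor put its lower side two units below the top of the room; being
  -- outside of the room costs the third unit.
  by_cases hsC : sC <;>
    simp only [anchor_of, anchor_of_not, hsC, not_false_eq_true, gridDist, Contains] at h ⊢ <;>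
    omega

theorem not_contains_corner (hC : C.IsHorizontal rooms) (hB : B ∈ rooms) :
    ¬ C.Contains (B.x₂, B.y₂) := by
  have h5 := hC.meet B hB
  have := C.hx; have := C.hy; have := B.hx; have := B.hy
  simp only [Contains]
  omega

theorem contains_anchor {s : Prop} : C.Contains (C.anchor s) := by
  have := C.hx; have := C.hy
  unfold anchor
  by_cases s <;> simp_all only [if_true, if_false, Contains] <;> omega

/-- The guard of a horizontal corridor stands on one of its two rooms. -/
theorem exists_contains_anchor {s : Prop} (hC : C.IsHorizontal rooms) :
    ∃ B ∈ rooms, B.Contains (C.anchor s) := by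
  obtain ⟨A, hA, B, hB, h1, h2, -⟩ := hC
  have := C.hx; have := C.hy; have := A.hx; have := A.hy; have := B.hx; have := B.hy
  unfold anchor
  by_cases s
  · refine ⟨A, hA, ?_⟩
    simp_all only [if_true, Contains]
    omega
  · refine ⟨B, hB, ?_⟩
    simp_all only [if_false, Contains]
    omega

/-- A corridor that overlooks another one does so through a common room. -/
theorem exists_room_of_overlooks {sC sD : Prop} (hrooms : rooms.Pairwise IntRect.Sep)
    (hC : C.IsHorizontal rooms) (hD : D.IsHorizontal rooms) (h : Overlooks sD sC D C) :
    ∃ B ∈ rooms, (C.HasLeft B ∨ C.HasRight B) ∧ B.Contains (D.anchor sD) ∧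
      C.y₁ ≤ (D.anchor sD).2 ∧ (D.anchor sD).2 ≤ C.y₂ := by
  obtain ⟨A, hA, B, hB, h1, h2, -⟩ := hC
  obtain ⟨A', hA', B', hB', h1', h2', -⟩ := hD
  have := C.hx; have := C.hy; have := A.hx; have := A.hy; have := B.hx; have := B.hy
  have := D.hx; have := D.hy; have := A'.hx; have := A'.hy; have := B'.hx; have := B'.hy
  obtain ⟨h0, ⟨hs, h⟩ | ⟨hs, h, -⟩⟩ := h
  · refine ⟨A, hA, Or.inl h1, ?_⟩
    -- A gap of at most two is too narrow for two disjoint rooms side by side.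
    have hAB : A = B' := by
      by_contra hne
      have := hrooms hA hB' hne
      omega
    subst hAB
    simp_all only [anchor, if_false, Contains]
    omega
  · refine ⟨B, hB, Or.inr h2, ?_⟩
    have hAB : B = A' := by
      by_contra hne
      have := hrooms hB hA' hne
      omega
    subst hAB
    simp_all only [anchor, if_true, Contains]
    omega

end Horizontal

/-! ### Rectangles in the real plane, lengths of paths, and the passage from room to room -/

/-- The `L₁`-distance of two points of the plane. -/
abbrev planeDist (p q : ℝ × ℝ) : ℝ := |p.1 - q.1| + |p.2 - q.2|

theorem planeDist_comm (p q : ℝ × ℝ) : planeDist p q = planeDist q p := by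
  simp only [planeDist, abs_sub_comm]

theorem IntRect.mem_toSet {R : IntRect} {p : ℝ × ℝ} :
    p ∈ R.toSet ↔ (R.x₁ ≤ p.1 ∧ p.1 ≤ R.x₂) ∧ R.y₁ ≤ p.2 ∧ p.2 ≤ R.y₂ := by
  simp only [toSet, Set.mem_Icc, Prod.le_def]
  tauto

theorem IntRect.isClosed_toSet (R : IntRect) : IsClosed R.toSet := isClosed_Icc

theorem IntRect.gridPoint_mem_toSet {R : IntRect} {v : ℤ × ℤ} :
    gridPoint v ∈ R.toSet ↔ R.Contains v := by
  simp only [mem_toSet, gridPoint, Int.cast_le, Contains]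
  tauto

theorem IntRect.sep_of_disjoint {A B : IntRect} (h : Disjoint A.toSet B.toSet) : A.Sep B := by
  by_contra hne
  have hA := A.hx; have := A.hy; have := B.hx; have := B.hy
  have h' : ∀ p ∈ A.toSet, p ∉ B.toSet := fun _ hp => Set.disjoint_left.1 h hp
  -- If no line separates the rectangles, the lower left corner of their intersection is a common
  -- point.
  refine h' (gridPoint (max A.x₁ B.x₁, max A.y₁ B.y₁)) ?_ ?_ <;>
  · rw [gridPoint_mem_toSet]
    simp only [Contains]
    omega

theorem IntRect.one_le_planeDist_of_sep {A B : IntRect} (h : A.Sep B) {p q : ℝ × ℝ}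
    (hp : p ∈ A.toSet) (hq : q ∈ B.toSet) : 1 ≤ planeDist p q := by
  rw [mem_toSet] at hp hq
  have h1 := abs_nonneg (p.1 - q.1)
  have h2 := abs_nonneg (p.2 - q.2)
  have h3 := le_abs_self (p.1 - q.1)
  have h4 := neg_abs_le (p.1 - q.1)
  have h5 := le_abs_self (p.2 - q.2)
  have h6 := neg_abs_le (p.2 - q.2)
  unfold planeDist
  rcases h with h | h | h | h <;> rw [← Int.add_one_le_iff] at h <;>
    have h' := (Int.cast_le (R := ℝ)).2 h <;> push_cast at h' <;> linarith

theorem IntRect.not_mem_of_sep {A B : IntRect} (h : A.Sep B) {p : ℝ × ℝ}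
    (hp : p ∈ A.toSet) : p ∉ B.toSet := fun hq => by
  have := one_le_planeDist_of_sep h hp hq
  norm_num [planeDist] at this

theorem IntRect.one_le_planeDist_of_not_contains {A : IntRect} {v : ℤ × ℤ} (h : ¬ A.Contains v)
    {p : ℝ × ℝ} (hp : p ∈ A.toSet) : 1 ≤ planeDist (gridPoint v) p := by
  rw [mem_toSet] at hp
  have h1 := abs_nonneg ((gridPoint v).1 - p.1)
  have h2 := abs_nonneg ((gridPoint v).2 - p.2)
  have h3 := le_abs_self ((gridPoint v).1 - p.1)
  have h4 := neg_abs_le ((gridPoint v).1 - p.1)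
  have h5 := le_abs_self ((gridPoint v).2 - p.2)
  have h6 := neg_abs_le ((gridPoint v).2 - p.2)
  have h7 : v.1 + 1 ≤ A.x₁ ∨ A.x₂ + 1 ≤ v.1 ∨ v.2 + 1 ≤ A.y₁ ∨ A.y₂ + 1 ≤ v.2 := by
    simp only [Contains] at h
    omega
  unfold planeDist
  unfold gridPoint at *
  rcases h7 with h | h | h | h <;>
    have h' := (Int.cast_le (R := ℝ)).2 h <;> push_cast at h' <;> linarith

theorem planeDist_gridPoint (v w : ℤ × ℤ) :
    planeDist (gridPoint v) (gridPoint w) = gridDist v w := by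
  simp only [planeDist, gridPoint, gridDist]
  push_cast [Nat.cast_natAbs]
  ring

theorem edist_toLp_one (p q : ℝ × ℝ) :
    edist (WithLp.toLp 1 p) (WithLp.toLp 1 q) = ENNReal.ofReal (planeDist p q) := by
  rw [WithLp.prod_edist_eq_add (by simp)]
  simp only [ENNReal.toReal_one, ENNReal.rpow_one, div_one, edist_dist, Real.dist_eq]
  exact (ENNReal.ofReal_add (abs_nonneg _) (abs_nonneg _)).symm

/-- The length of a path is at least the length of the polygon through six of its points. -/
theorem le_l1Length {p q : ℝ × ℝ} (γ : Path p q) {u₁ u₂ u₃ u₄ : unitInterval}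
    (h₁ : u₁ ≤ u₂) (h₂ : u₂ ≤ u₃) (h₃ : u₃ ≤ u₄) {d : ℝ}
    (hd : d ≤ planeDist p (γ u₁) + planeDist (γ u₁) (γ u₂) + planeDist (γ u₂) (γ u₃) +
      planeDist (γ u₃) (γ u₄) + planeDist (γ u₄) q) :
    ENNReal.ofReal d ≤ l1Length γ := by
  let u : ℕ → unitInterval := fun n =>
    match n with
    | 0 => 0
    | 1 => u₁
    | 2 => u₂
    | 3 => u₃
    | 4 => u₄
    | _ => 1
  have hu : Monotone u := by
    refine monotone_nat_of_le_succ fun n => ?_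
    match n with
    | 0 => exact unitInterval.nonneg u₁
    | 1 => exact h₁
    | 2 => exact h₂
    | 3 => exact h₃
    | 4 => exact unitInterval.le_one u₄
    | n + 5 => exact le_rfl
  have key := eVariationOn.sum_le (f := fun t => WithLp.toLp 1 (γ t)) (s := Set.univ) (n := 5) hu
    (fun _ => Set.mem_univ _)
  refine le_trans ?_ key
  simp only [edist_toLp_one]
  rw [← ENNReal.ofReal_sum_of_nonneg (fun i _ => by positivity)]
  refine ENNReal.ofReal_le_ofReal (hd.trans (le_of_eq ?_))
  simp only [Finset.sum_range_succ, Finset.sum_range_zero, u, γ.source, γ.target, zero_add]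
  rw [planeDist_comm p (γ u₁), planeDist_comm (γ u₁) (γ u₂), planeDist_comm (γ u₂) (γ u₃),
    planeDist_comm (γ u₃) (γ u₄), planeDist_comm (γ u₄) q]

theorem planeDist_le_l1Length {p q : ℝ × ℝ} (γ : Path p q) {d : ℝ} (hd : d ≤ planeDist p q) :
    ENNReal.ofReal d ≤ l1Length γ := by
  -- All four intermediate points collapse to the starting point.
  refine le_l1Length γ (u₁ := 0) (u₂ := 0) (u₃ := 0) (u₄ := 0) le_rfl le_rfl le_rfl ?_
  simpa [planeDist] using hd

/-- A curve that leaves a room runs through a corridor to another room. -/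
theorem exists_exit {rooms cors : List IntRect}
    (hrooms : ∀ A ∈ rooms, ∀ B ∈ rooms, A ≠ B → A.Sep B)
    (hcors : ∀ C ∈ cors, ∀ D ∈ cors, C ≠ D → C.Sep D)
    {f : ℝ → ℝ × ℝ} (hf : Continuous f) {a b : ℝ} (hab : a ≤ b)
    (hreg : ∀ t ∈ Set.Icc a b, f t ∈ ⋃ R ∈ rooms ++ cors, R.toSet)
    {A B : IntRect} (hA : A ∈ rooms) (hB : B ∈ rooms) (hAB : A ≠ B)
    (ha : f a ∈ A.toSet) (hb : f b ∈ B.toSet) :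
    ∃ u v : ℝ, a ≤ u ∧ u ≤ v ∧ v ≤ b ∧ ∃ C ∈ cors, ∃ A' ∈ rooms, A ≠ A' ∧
      f u ∈ A.toSet ∧ f u ∈ C.toSet ∧ f v ∈ A'.toSet ∧ f v ∈ C.toSet := by
  have hclosed : ∀ (l : List IntRect) (p : IntRect → Prop),
      IsClosed (⋃ R ∈ {R | R ∈ l ∧ p R}, R.toSet) := fun l p =>
    (l.finite_toSet.subset fun _ h => h.1).isClosed_biUnion fun R _ => R.isClosed_toSet
  -- `u` is the last time in `A`, and `v` below is the first later time in another room. Strictly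
  -- between them the curve is in corridors only.
  obtain ⟨u, ⟨huI, huA⟩, humax⟩ :=
    (isCompact_Icc.inter_right (A.isClosed_toSet.preimage hf)).exists_isGreatest
      ⟨a, Set.left_mem_Icc.2 hab, ha⟩
  have hO := hclosed rooms fun R => A ≠ R
  obtain ⟨v, ⟨hvI, hvO⟩, hvmin⟩ :=
    (isCompact_Icc.inter_right (hO.preimage hf)).exists_isLeast
      ⟨b, Set.right_mem_Icc.2 huI.2, Set.mem_biUnion (x := B) ⟨hB, hAB⟩ hb⟩
  obtain ⟨A', ⟨hA', hne⟩, hvA'⟩ := Set.mem_iUnion₂.1 hvO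
  have huv : u < v := by
    refine lt_of_le_of_ne hvI.1 fun h => ?_
    subst h
    exact not_mem_of_sep (hrooms A hA A' hA' hne) huA hvA'
  have hcor : ∀ t ∈ Set.Ioo u v, ∃ C ∈ cors, f t ∈ C.toSet := by
    intro t ht
    have htI : t ∈ Set.Icc a b := ⟨huI.1.trans ht.1.le, ht.2.le.trans hvI.2⟩
    obtain ⟨R, hR, htR⟩ := Set.mem_iUnion₂.1 (hreg t htI)
    rcases List.mem_append.1 hR with hR | hR
    · exfalso
      by_cases hRA : A = R
      · subst hRA
        exact ht.1.not_ge (humax ⟨htI, htR⟩)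
      · exact ht.2.not_ge (hvmin ⟨⟨ht.1.le, htI.2⟩, Set.mem_biUnion (x := R) ⟨hR, hRA⟩ htR⟩)
    · exact ⟨R, hR, htR⟩
  obtain ⟨m, hm⟩ := Set.nonempty_Ioo.2 huv
  obtain ⟨C, hC, hmC⟩ := hcor m hm
  -- The corridors are finitely many disjoint closed sets, so the connected interval stays in one of
  -- them; by closedness its end points do, too.
  have hsub : Set.Ioo u v ⊆ f ⁻¹' C.toSet := by
    rcases isPreconnected_iff_subset_of_disjoint_closed.1 (isPreconnected_Ioo (a := u) (b := v))
      _ _ (C.isClosed_toSet.preimage hf) ((hclosed cors fun D => C ≠ D).preimage hf) (by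
        intro t ht
        obtain ⟨D, hD, htD⟩ := hcor t ht
        by_cases hCD : C = D
        · subst hCD
          exact Or.inl htD
        · exact Or.inr (Set.mem_biUnion (x := D) ⟨hD, hCD⟩ htD)) (by
        refine Set.eq_empty_of_forall_notMem fun t ⟨_, htC, ht⟩ => ?_
        obtain ⟨D, ⟨hD, hCD⟩, htD⟩ := Set.mem_iUnion₂.1 ht
        exact not_mem_of_sep (hcors C hC D hD hCD) htC htD) with h | h
    · exact h
    · obtain ⟨D, ⟨hD, hCD⟩, htD⟩ := Set.mem_iUnion₂.1 (h hm)
      exact absurd htD (not_mem_of_sep (hcors C hC D hD hCD) hmC)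
  have hcl : Set.Icc u v ⊆ f ⁻¹' C.toSet := by
    rw [← closure_Ioo huv.ne]
    exact closure_minimal hsub (C.isClosed_toSet.preimage hf)
  exact ⟨u, v, huI.1, huv.le, hvI.2, C, hC, A', hA', hne, huA, hcl (Set.left_mem_Icc.2 huv.le),
    hvA', hcl (Set.right_mem_Icc.2 huv.le)⟩

/-- A curve between two rooms either runs through a corridor that links them, or leaves the first
room through a corridor and enters the second one, later, through another corridor. -/
theorem exists_passage {rooms cors : List IntRect}
    (hrooms : ∀ A ∈ rooms, ∀ B ∈ rooms, A ≠ B → A.Sep B)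
    (hcors : ∀ C ∈ cors, ∀ D ∈ cors, C ≠ D → C.Sep D)
    {p q : ℝ × ℝ} (γ : Path p q) (hreg : ∀ t, γ t ∈ ⋃ R ∈ rooms ++ cors, R.toSet)
    {A B : IntRect} (hA : A ∈ rooms) (hB : B ∈ rooms) (hAB : A ≠ B)
    (hp : p ∈ A.toSet) (hq : q ∈ B.toSet) :
    (∃ u v : unitInterval, u ≤ v ∧ ∃ C ∈ cors, γ u ∈ A.toSet ∧ γ u ∈ C.toSet ∧
      γ v ∈ B.toSet ∧ γ v ∈ C.toSet) ∨
    (∃ u₁ u₂ u₃ u₄ : unitInterval, u₁ ≤ u₂ ∧ u₂ ≤ u₃ ∧ u₃ ≤ u₄ ∧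
      ∃ C ∈ cors, ∃ D ∈ cors, ∃ A' ∈ rooms, ∃ B' ∈ rooms, A ≠ A' ∧ A' ≠ B ∧ B ≠ B' ∧
      γ u₁ ∈ A.toSet ∧ γ u₁ ∈ C.toSet ∧ γ u₂ ∈ A'.toSet ∧ γ u₂ ∈ C.toSet ∧
      γ u₃ ∈ B'.toSet ∧ γ u₃ ∈ D.toSet ∧ γ u₄ ∈ B.toSet ∧ γ u₄ ∈ D.toSet) := by
  have hext : ∀ {t : ℝ} (h0 : 0 ≤ t) (h1 : t ≤ 1), γ.extend t = γ ⟨t, h0, h1⟩ := fun h0 h1 =>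
    Path.extend_apply γ ⟨h0, h1⟩
  obtain ⟨u, v, h0u, huv, hv1, C, hC, A', hA', hne, h1, h2, h3, h4⟩ :=
    exists_exit hrooms hcors γ.continuous_extend zero_le_one
      (fun t ht => by rw [hext ht.1 ht.2]; exact hreg _) hA hB hAB
      (by simpa using hp) (by simpa using hq)
  have h0v := h0u.trans huv
  have hu1 := huv.trans hv1
  rw [hext h0u hu1] at h1 h2
  by_cases hA'B : A' = B
  · subst hA'B
    rw [hext h0v hv1] at h3 h4
    exact Or.inl ⟨_, _, huv, C, hC, h1, h2, h3, h4⟩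
  -- The same argument for the reversed curve from `B` back to `A'` over the times `[v, 1]` yields
  -- the last entry into `B`.
  obtain ⟨s, t, h0s, hst, ht1, D, hD, B', hB', hne', h5, h6, h7, h8⟩ :=
    exists_exit hrooms hcors (f := fun s => γ.extend (v + 1 - s))
      (γ.continuous_extend.comp (by fun_prop)) hv1
      (fun t ht => by
        rw [hext (by linarith [ht.2]) (by linarith [ht.1])]; exact hreg _) hB hA' (Ne.symm hA'B)
      (by simpa using hq) (by simpa using h3)
  rw [hext h0v hv1] at h3 h4
  rw [hext (by linarith) (by linarith)] at h5 h6 h7 h8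
  refine Or.inr ⟨_, _, _, _, huv, ?_, ?_, C, hC, D, hD, A', hA', B', hB', hne, hA'B, hne', h1, h2,
    h3, h4, h7, h8, h5, h6⟩
  · exact Subtype.mk_le_mk.2 (by linarith)
  · exact Subtype.mk_le_mk.2 (by linarith)

/-! ### Guard plans: the choice of the guards, and its correctness -/

/-- The wall between room and corridor cuts the spanned rectangle in two. Its heights are those of
the corridor, hence also heights of the room. -/
theorem uIcc_subset_of_hasLeft_or_hasRight {B C : IntRect} {g : ℤ × ℤ} {p : ℝ × ℝ}
    (h : C.HasLeft B ∨ C.HasRight B) (hg : B.Contains g) (h₁ : C.y₁ ≤ g.2) (h₂ : g.2 ≤ C.y₂)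
    (hp : p ∈ C.toSet) : Set.uIcc (gridPoint g) p ⊆ B.toSet ∪ C.toSet := by
  intro z hz
  have hz1 : z.1 ∈ Set.uIcc (gridPoint g).1 p.1 := ⟨hz.1.1, hz.2.1⟩
  have hz2 : z.2 ∈ Set.uIcc (gridPoint g).2 p.2 := ⟨hz.1.2, hz.2.2⟩
  rw [Set.mem_union, mem_toSet, mem_toSet]
  rw [mem_toSet] at hp
  simp only [gridPoint] at hz1 hz2
  obtain ⟨hg1, hg2, hg3, hg4⟩ := hg
  rify at hg1 hg2 hg3 hg4 h₁ h₂
  have hz2' : (C.y₁ : ℝ) ≤ z.2 ∧ z.2 ≤ C.y₂ := by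
    rcases Set.mem_uIcc.1 hz2 with h | h <;> constructor <;> linarith
  rcases h with ⟨h, h3, h4⟩ | ⟨h, h3, h4⟩
  · rify at h h3 h4
    have hz1' : (B.x₁ : ℝ) ≤ z.1 ∧ z.1 ≤ C.x₂ := by
      rcases Set.mem_uIcc.1 hz1 with h | h <;> constructor <;> linarith
    rcases le_total z.1 B.x₂ with h5 | h5
    · exact Or.inl ⟨⟨hz1'.1, h5⟩, by linarith, by linarith⟩
    · exact Or.inr ⟨⟨by linarith, hz1'.2⟩, hz2'⟩
  · rify at h h3 h4
    have hz1' : (C.x₁ : ℝ) ≤ z.1 ∧ z.1 ≤ B.x₂ := by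
      rcases Set.mem_uIcc.1 hz1 with h | h <;> constructor <;> linarith
    rcases le_total z.1 B.x₁ with h5 | h5
    · exact Or.inr ⟨⟨hz1'.1, by linarith⟩, hz2'⟩
    · exact Or.inl ⟨⟨h5, hz1'.2⟩, by linarith, by linarith⟩

theorem IntRect.swap_mem_toSet_swap {R : IntRect} {p : ℝ × ℝ} :
    p.swap ∈ R.swap.toSet ↔ p ∈ R.toSet := by
  simp only [mem_toSet, Prod.fst_swap, Prod.snd_swap]
  exact and_comm

theorem swap_mem_uIcc_swap {p q z : ℝ × ℝ} (h : z ∈ Set.uIcc p q) :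
    z.swap ∈ Set.uIcc p.swap q.swap :=
  ⟨⟨h.1.2, h.1.1⟩, ⟨h.2.2, h.2.1⟩⟩

theorem gridDist_comm (p q : ℤ × ℤ) : gridDist p q = gridDist q p := by
  simp only [gridDist]
  omega

namespace OfficeLikePolygon

variable (P : OfficeLikePolygon)

/-- The rooms as a set. -/
abbrev roomSet : Set IntRect := {R | R ∈ P.rooms}

/-- The corridor is horizontal. -/
abbrev Hor (C : IntRect) : Prop := C.IsHorizontal P.roomSet

open Classical in
/-- A horizontal corridor, or the reflection of a vertical one. -/
noncomputable def normal (C : IntRect) : IntRect := if P.Hor C then C else C.swap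

/-- The relation `IntRect.Stacked` for corridors of the same direction. -/
def StackedOn (D C : IntRect) : Prop :=
  (P.Hor D ↔ P.Hor C) ∧ (P.normal D).Stacked (P.normal C)

/-- The relation `IntRect.Overlooks` for corridors of the same direction. -/
def OverlooksFrom (left : IntRect → Prop) (D C : IntRect) : Prop :=
  (P.Hor D ↔ P.Hor C) ∧ Overlooks (left D) (left C) (P.normal D) (P.normal C)

open Classical in
/-- The guard of a corridor. -/
noncomputable def guard (left : IntRect → Prop) (C : IntRect) : ℤ × ℤ :=
  if P.Hor C then C.anchor (left C) else (C.swap.anchor (left C)).swap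

/-- A choice of the side of each corridor at which its guard stands, and of the corridors whose
guards are kept. -/
structure GuardPlan where
  left : IntRect → Prop
  kept : IntRect → Prop
  left_iff : ∀ C ∈ P.corridors, left C ↔ ∀ D ∈ P.corridors, P.StackedOn D C → ¬ left D
  kept_iff : ∀ C ∈ P.corridors, kept C ↔ ∀ D ∈ P.corridors, P.OverlooksFrom left D C → ¬ kept D

variable {P}

theorem sep_of_pairwise_disjoint {l : List IntRect}
    (hl : l.Pairwise fun A B => Disjoint A.toSet B.toSet) {A B : IntRect} (hA : A ∈ l)
    (hB : B ∈ l) (h : A ≠ B) : A.Sep B :=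
  have : Std.Symm fun A B : IntRect => Disjoint A.toSet B.toSet := ⟨fun _ _ h => h.symm⟩
  sep_of_disjoint (hl.forall hA hB h)

theorem rooms_sep {A B : IntRect} (hA : A ∈ P.rooms) (hB : B ∈ P.rooms) (h : A ≠ B) : A.Sep B :=
  sep_of_pairwise_disjoint P.rooms_disjoint hA hB h

theorem corridors_sep {C D : IntRect} (hC : C ∈ P.corridors) (hD : D ∈ P.corridors)
    (h : C ≠ D) : C.Sep D :=
  sep_of_pairwise_disjoint P.corridors_disjoint hC hD h

theorem roomSet_pairwise : P.roomSet.Pairwise IntRect.Sep := fun _ hA _ hB h => rooms_sep hA hB h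

theorem swap_roomSet_pairwise : (swap ⁻¹' P.roomSet).Pairwise IntRect.Sep := by
  intro A hA B hB h
  have := rooms_sep (P := P) (A := A.swap) (B := B.swap) hA hB
    (fun h' => h (congrArg IntRect.swap h'))
  simp only [IntRect.Sep] at this ⊢
  omega

theorem hor_or_swap {C : IntRect} (hC : C ∈ P.corridors) :
    P.Hor C ∨ C.swap.IsHorizontal (swap ⁻¹' P.roomSet) := by
  obtain ⟨A, hA, B, hB, h | h, h'⟩ := P.corridors_link C hC
  · exact Or.inl ⟨A, hA, B, hB, h.1, h.2, fun R hR h1 h2 => sep_of_disjoint (h' R hR h1 h2)⟩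
  · refine Or.inr ⟨A.swap, hA, B.swap, hB, h.1, h.2, fun R hR h1 h2 => ?_⟩
    have := sep_of_disjoint (h' R.swap hR (fun h => h1 (congrArg IntRect.swap h))
      (fun h => h2 (congrArg IntRect.swap h)))
    simp only [IntRect.Sep] at this ⊢
    omega

theorem swap_of_not_hor {C : IntRect} (hC : C ∈ P.corridors) (h : ¬ P.Hor C) :
    C.swap.IsHorizontal (swap ⁻¹' P.roomSet) := (hor_or_swap hC).resolve_left h

/-- A corridor is horizontal if and only if its left side lies in the right edge of a room. -/
theorem hor_iff {C : IntRect} (hC : C ∈ P.corridors) :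
    P.Hor C ↔ ∃ A ∈ P.rooms, C.HasLeft A := by
  refine ⟨fun ⟨A, hA, _, _, h, _⟩ => ⟨A, hA, h⟩, fun ⟨A, hA, h⟩ => ?_⟩
  by_contra hne
  have h' := (swap_of_not_hor hC hne).meet A.swap hA
  have := C.hx; have := C.hy; have := A.hx; have := A.hy
  simp only [IntRect.Sep, HasLeft, HasRight] at h h'
  omega

/-- A corridor meets at most two rooms. -/
theorem eq_or_eq_of_not_sep {C A A' B : IntRect} (hC : C ∈ P.corridors) (hA : A ∈ P.rooms)
    (hA' : A' ∈ P.rooms) (hB : B ∈ P.rooms) (hne : A ≠ A') (h₁ : ¬ C.Sep A) (h₂ : ¬ C.Sep A')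
    (h₃ : ¬ C.Sep B) : B = A ∨ B = A' := by
  obtain ⟨D, -, E, -, -, h⟩ := P.corridors_link C hC
  have key : ∀ R ∈ P.rooms, ¬ C.Sep R → R = D ∨ R = E := by
    intro R hR hCR
    by_contra! hne
    exact hCR (sep_of_disjoint (h R hR hne.1 hne.2))
  have := key A hA h₁
  have := key A' hA' h₂
  have := key B hB h₃
  grind

theorem contains_guard {left : IntRect → Prop} (C : IntRect) : C.Contains (P.guard left C) := by
  unfold guard
  split_ifs
  · exact contains_anchor
  · have := contains_anchor (C := C.swap) (s := left C)
    simp only [Contains, Prod.fst_swap, Prod.snd_swap] at this ⊢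
    tauto

theorem exists_contains_guard {left : IntRect → Prop} {C : IntRect} (hC : C ∈ P.corridors) :
    ∃ B ∈ P.rooms, B.Contains (P.guard left C) := by
  unfold guard
  split_ifs with h
  · exact exists_contains_anchor h
  · obtain ⟨B, hB, h'⟩ := exists_contains_anchor (s := left C) (swap_of_not_hor hC h)
    refine ⟨B.swap, hB, ?_⟩
    simp only [Contains, Prod.fst_swap, Prod.snd_swap] at h' ⊢
    tauto

theorem guard_mem_corners {left : IntRect → Prop} (C : IntRect) :
    P.guard left C ∈ C.corners := by
  unfold guard anchor corners
  split_ifs <;> simp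

theorem gridDist_corner_guard {left : IntRect → Prop} {C B : IntRect} (hC : C ∈ P.corridors)
    (hB : B ∈ P.rooms) (hCB : ¬ C.Sep B) (h : ¬ B.Contains (P.guard left C)) :
    3 ≤ gridDist (B.x₂, B.y₂) (P.guard left C) := by
  unfold guard at *
  split_ifs at * with hor
  · exact gridDist_corner_anchor hor hB hCB h
  · have := gridDist_corner_anchor (swap_of_not_hor hC hor) (B := B.swap) (sC := left C) hB
      (by simp only [IntRect.Sep] at hCB ⊢; omega)
      (by simp only [Contains, Prod.fst_swap, Prod.snd_swap] at h ⊢; tauto)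
    simp only [gridDist, Prod.fst_swap, Prod.snd_swap] at this ⊢
    omega

theorem not_contains_corner {C B : IntRect} (hC : C ∈ P.corridors) (hB : B ∈ P.rooms) :
    ¬ C.Contains (B.x₂, B.y₂) := by
  rcases hor_or_swap hC with h | h
  · exact _root_.not_contains_corner h hB
  · have := _root_.not_contains_corner (B := B.swap) h hB
    simp only [Contains] at this ⊢
    tauto

theorem not_sep_of_contains {A B : IntRect} {v : ℤ × ℤ} (hA : A.Contains v) (hB : B.Contains v) :
    ¬ A.Sep B := by
  simp only [Contains, IntRect.Sep] at *
  omega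

theorem sees_of_mem {R : IntRect} (hR : R ∈ P.rooms ++ P.corridors) {p q : ℝ × ℝ}
    (hp : p ∈ R.toSet) (hq : q ∈ R.toSet) : P.Sees p q :=
  (Set.uIcc_subset_Icc hp hq).trans (Set.subset_biUnion_of_mem (u := IntRect.toSet) hR)

theorem sees_of_overlooksFrom {left : IntRect → Prop} {C D : IntRect} (hC : C ∈ P.corridors)
    (hD : D ∈ P.corridors) (h : P.OverlooksFrom left D C) {p : ℝ × ℝ} (hp : p ∈ C.toSet) :
    P.Sees (gridPoint (P.guard left D)) p := by
  have hreg : ∀ R ∈ P.rooms ++ P.corridors, R.toSet ⊆ P.region := fun R hR =>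
    Set.subset_biUnion_of_mem (u := IntRect.toSet) hR
  obtain ⟨h1, h2⟩ := h
  by_cases hor : P.Hor C
  · have hor' := h1.2 hor
    simp only [guard, normal, hor, hor', if_true] at h2 ⊢
    obtain ⟨B, hB, h3, h4, h5, h6⟩ := exists_room_of_overlooks roomSet_pairwise hor hor' h2
    exact (uIcc_subset_of_hasLeft_or_hasRight h3 h4 h5 h6 hp).trans
      (Set.union_subset (hreg B (List.mem_append_left _ hB)) (hreg C (List.mem_append_right _ hC)))
  · have hor' := mt h1.1 hor
    simp only [guard, normal, hor, hor', if_false] at h2 ⊢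
    obtain ⟨B, hB, h3, h4, h5, h6⟩ := exists_room_of_overlooks swap_roomSet_pairwise
      (swap_of_not_hor hC hor) (swap_of_not_hor hD hor') h2
    intro z hz
    have := uIcc_subset_of_hasLeft_or_hasRight h3 h4 h5 h6 (swap_mem_toSet_swap.2 hp)
      (swap_mem_uIcc_swap hz)
    rcases this with this | this
    · exact hreg B.swap (List.mem_append_left _ hB)
        (swap_mem_toSet_swap (R := B.swap).1 this)
    · exact hreg C (List.mem_append_right _ hC) (swap_mem_toSet_swap.1 this)

/-! ### Distance and visibility for the guards of a plan -/

namespace GuardPlan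

variable (S : P.GuardPlan)

/-- By disjointness only one corridor lies directly beneath `C`, so the kernel condition becomes
strict alternation along a stack. -/
theorem left_iff_not_left {C D : IntRect} (hC : C ∈ P.corridors) (hD : D ∈ P.corridors)
    (h : P.StackedOn D C) : S.left C ↔ ¬ S.left D := by
  refine ⟨fun h' => (S.left_iff C hC).1 h' D hD h, fun h' => (S.left_iff C hC).2 ?_⟩
  intro E hE hEC hleft
  by_cases hED : E = D
  · subst hED; exact h' hleft
  have h1 := corridors_sep hE hD hED
  obtain ⟨h2, h3⟩ := h
  obtain ⟨h4, h5⟩ := hEC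
  have := C.hx; have := C.hy; have := D.hx; have := D.hy; have := E.hx; have := E.hy
  by_cases hor : P.Hor C
  · simp only [normal, h2.2 hor, h4.2 hor, hor, if_true, Stacked, IntRect.Sep] at *
    omega
  · simp only [normal, mt h2.1 hor, mt h4.1 hor, hor, if_false, Stacked, IntRect.Sep] at *
    omega

theorem exists_stackedOn {C : IntRect} (hC : C ∈ P.corridors) (h : ¬ S.left C) :
    ∃ D ∈ P.corridors, P.StackedOn D C := by
  by_contra! hne
  exact h ((S.left_iff C hC).2 fun D hD h' => absurd h' (hne D hD))

/-- Two kept guards have distance at least three if one of them stands on a room that the corridor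
of the other one meets. -/
theorem three_le_gridDist {C D B : IntRect} (hC : C ∈ P.corridors) (hD : D ∈ P.corridors)
    (hCD : C ≠ D) (hCk : S.kept C) (hDk : S.kept D) (hB : B ∈ P.rooms)
    (hDB : B.Contains (P.guard S.left D)) (hCB : ¬ C.Sep B) :
    3 ≤ gridDist (P.guard S.left C) (P.guard S.left D) := by
  have hDB' : ¬ D.Sep B := not_sep_of_contains (contains_guard D) hDB
  have hsep := corridors_sep hD hC hCD.symm
  have h1 := S.left_iff_not_left hC hD
  have h2 := S.left_iff_not_left hD hC
  have h3 : ¬ P.OverlooksFrom S.left D C := fun h => (S.kept_iff C hC).1 hCk D hD h hDk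
  have h4 : ¬ P.OverlooksFrom S.left C D := fun h => (S.kept_iff D hD).1 hDk C hC h hCk
  -- A right end is chosen only on top of another corridor, which needs its own unit of margin above
  -- the bottom of `B`.
  have hlow : ∀ E ∈ P.corridors, P.Hor E → ¬ S.left E → E.HasRight B → B.y₁ + 2 < E.y₁ := by
    intro E hE hor hl hr
    obtain ⟨F, hF, hFE, hFE'⟩ := S.exists_stackedOn hE hl
    have hor' := hFE.2 hor
    simp only [normal, hor, hor', if_true] at hFE'
    exact add_two_lt_of_stacked roomSet_pairwise hor' hB hr hFE'
  by_cases horC : P.Hor C <;> by_cases horD : P.Hor D <;>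
    simp only [StackedOn, OverlooksFrom, guard, normal, horC, horD, if_true, if_false, true_and,
      iff_self] at h1 h2 h3 h4 hDB ⊢
  · exact gridDist_anchor_anchor horC horD hsep hB hDB hCB h1 h2 h3 h4
  · exact gridDist_anchor_anchor_swap horC (swap_of_not_hor hD horD) hB hCB hDB' (Or.inr hDB)
      (hlow C hC horC)
  · rw [gridDist_comm]
    exact gridDist_anchor_anchor_swap horD (swap_of_not_hor hC horC) hB hDB' hCB (Or.inl hDB)
      (hlow D hD horD)
  · have := gridDist_anchor_anchor (B := B.swap) (swap_of_not_hor hC horC)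
      (swap_of_not_hor hD horD) (by simp only [IntRect.Sep] at hsep ⊢; omega) hB
      (by simp only [Contains, Prod.fst_swap, Prod.snd_swap] at hDB ⊢; tauto)
      (by simp only [IntRect.Sep] at hCB ⊢; omega) h1 h2 h3 h4
    simp only [gridDist, Prod.fst_swap, Prod.snd_swap] at this ⊢
    omega

/-- No kept guard stands on the room. -/
def Unguarded (R : IntRect) : Prop :=
  ∀ C ∈ P.corridors, S.kept C → ¬ R.Contains (P.guard S.left C)

/-- A point is a guard that stands on the room `A`. -/
def GuardAt (g : ℤ × ℤ) (A : IntRect) : Prop :=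
  A ∈ P.rooms ∧ A.Contains g ∧ ((∃ C ∈ P.corridors, S.kept C ∧ g = P.guard S.left C) ∨
    (S.Unguarded A ∧ g = (A.x₂, A.y₂)))

variable {S}

/-- A guard in a corridor is the guard of this corridor. -/
theorem GuardAt.eq_guard {g : ℤ × ℤ} {A C : IntRect} (hg : S.GuardAt g A)
    (hC : C ∈ P.corridors) (hgC : C.Contains g) : S.kept C ∧ g = P.guard S.left C := by
  obtain ⟨hA, -, ⟨D, hD, hDk, rfl⟩ | ⟨-, rfl⟩⟩ := hg
  · have : D = C := by
      by_contra hne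
      exact not_sep_of_contains (contains_guard D) hgC (corridors_sep hD hC hne)
    subst this
    exact ⟨hDk, rfl⟩
  · exact absurd hgC (not_contains_corner hC hA)

/-- The guard of a corridor is far from the guards on the room at its other end. -/
theorem GuardAt.three_le_gridDist {g : ℤ × ℤ} {B C : IntRect} (hg : S.GuardAt g B)
    (hC : C ∈ P.corridors) (hCk : S.kept C) (hne : g ≠ P.guard S.left C) (hCB : ¬ C.Sep B)
    (hCB' : S.Unguarded B → ¬ B.Contains (P.guard S.left C)) :
    3 ≤ gridDist (P.guard S.left C) g := by
  obtain ⟨hB, hgB, ⟨D, hD, hDk, rfl⟩ | ⟨h, rfl⟩⟩ := hg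
  · exact S.three_le_gridDist hC hD (fun h => hne (by rw [h])) hCk hDk hB hgB hCB
  · rw [gridDist_comm]
    exact gridDist_corner_guard hC hB hCB (hCB' h)

/-- Planar distance settles guards on one room, and guards in a corridor that links their rooms.
Otherwise a path contains three disjoint pieces, each between integer objects at distance at least
one. -/
theorem three_le_geodesicDist {g h : ℤ × ℤ} {A B : IntRect} (hg : S.GuardAt g A)
    (hh : S.GuardAt h B) (hne : g ≠ h) :
    3 ≤ geodesicDist P.region (gridPoint g) (gridPoint h) := by
  have h3 : (3 : ℝ≥0∞) = ENNReal.ofReal 3 := by norm_num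
  refine le_iInf₂ fun γ hγ => ?_
  rw [h3]
  have hplane : 3 ≤ gridDist g h → ENNReal.ofReal 3 ≤ l1Length γ := fun hd => by
    refine planeDist_le_l1Length γ ?_
    rw [planeDist_gridPoint]
    exact_mod_cast hd
  have hunique : ∀ {R R' : IntRect}, R ∈ P.rooms → R' ∈ P.rooms → ∀ {v}, R.Contains v →
      R'.Contains v → R = R' := fun hR hR' v h h' => by
    by_contra hRR'
    exact not_sep_of_contains h h' (rooms_sep hR hR' hRR')
  have hmeet : ∀ {C R : IntRect} {p : ℝ × ℝ}, p ∈ C.toSet → p ∈ R.toSet → ¬ C.Sep R :=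
    fun h h' hs => not_mem_of_sep hs h h'
  by_cases hAB : A = B
  · subst hAB
    refine hplane ?_
    obtain ⟨hA, hgA, ⟨C, hC, hCk, rfl⟩ | ⟨hA', rfl⟩⟩ := id hg
    · refine hh.three_le_gridDist hC hCk hne.symm
        (not_sep_of_contains (contains_guard C) hgA) fun h => absurd hgA (h C hC hCk)
    · obtain ⟨-, hhA, ⟨D, hD, hDk, rfl⟩ | ⟨-, rfl⟩⟩ := hh
      · exact absurd hhA (hA' D hD hDk)
      · exact absurd rfl hne
  have hA := hg.1
  have hB := hh.1
  rcases exists_passage (fun A hA B hB h => rooms_sep hA hB h)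
    (fun A hA B hB h => corridors_sep hA hB h) γ hγ hA hB hAB
    (gridPoint_mem_toSet.2 hg.2.1) (gridPoint_mem_toSet.2 hh.2.1) with
    ⟨u, v, huv, C, hC, huA, huC, hvB, hvC⟩ |
    ⟨u₁, u₂, u₃, u₄, h12, h23, h34, C, hC, D, hD, A', hA', B', hB', hAA', hAB', hBB', hu1A, hu1C,
      hu2A, hu2C, hu3B, hu3D, hu4B, hu4D⟩
  · by_cases hgC : C.Contains g
    · obtain ⟨hCk, rfl⟩ := hg.eq_guard hC hgC
      exact hplane (hh.three_le_gridDist hC hCk hne.symm (hmeet hvC hvB)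
        fun _ h => hAB (hunique hA hB hg.2.1 h))
    by_cases hhC : C.Contains h
    · obtain ⟨hCk, rfl⟩ := hh.eq_guard hC hhC
      rw [gridDist_comm] at hplane
      exact hplane (hg.three_le_gridDist hC hCk hne (hmeet huC huA)
        fun _ h => hAB (hunique hA hB h hh.2.1))
    -- Both guards lie outside of the linking corridor: one unit to reach it, one to cross it, one
    -- to get from it to the other guard.
    refine le_l1Length γ huv le_rfl le_rfl ?_
    have h1 := one_le_planeDist_of_not_contains hgC huC
    have h2 := one_le_planeDist_of_sep (rooms_sep hA hB hAB) huA hvB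
    have h4 := one_le_planeDist_of_not_contains hhC hvC
    rw [planeDist_comm] at h4
    have h5 : 0 ≤ planeDist (γ v) (γ v) := by positivity
    linarith
  -- Otherwise this corridor would meet the three different rooms `A`, `A'` and `B`.
  · have hCD : C ≠ D := by
      rintro rfl
      rcases eq_or_eq_of_not_sep hC hA hA' hB hAA' (hmeet hu1C hu1A) (hmeet hu2C hu2A)
        (hmeet hu4D hu4B) with h | h
      · exact hAB h.symm
      · exact hAB' h.symm
    -- The three units: across `C`, from `C` to `D`, across `D`.
    refine le_l1Length γ h12 h23 h34 ?_
    have h1 : 0 ≤ planeDist (gridPoint g) (γ u₁) := by positivity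
    have h2 := one_le_planeDist_of_sep (rooms_sep hA hA' hAA') hu1A hu2A
    have h3 := one_le_planeDist_of_sep (corridors_sep hC hD hCD) hu2C hu3D
    have h4 := one_le_planeDist_of_sep (rooms_sep hB hB' hBB') hu4B hu3B
    rw [planeDist_comm] at h4
    have h5 : 0 ≤ planeDist (γ u₄) (gridPoint h) := by positivity
    linarith

variable (S)

/-- The set of guards that belongs to a guard plan. -/
def IsGuardSet (G : Finset (ℤ × ℤ)) : Prop :=
  ∀ v, v ∈ G ↔ (∃ C ∈ P.corridors, S.kept C ∧ v = P.guard S.left C) ∨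
    (∃ R ∈ P.rooms, S.Unguarded R ∧ v = (R.x₂, R.y₂))

variable {S}

theorem IsGuardSet.three_le_dispersion {G : Finset (ℤ × ℤ)} (hG : S.IsGuardSet G) :
    3 ≤ P.dispersion G := by
  have key : ∀ g ∈ G, ∃ A, S.GuardAt g A := by
    intro g hg
    rcases (hG g).1 hg with ⟨C, hC, hCk, rfl⟩ | ⟨R, hR, hu, rfl⟩
    · obtain ⟨A, hA, h⟩ := exists_contains_guard (left := S.left) hC
      exact ⟨A, hA, h, Or.inl ⟨C, hC, hCk, rfl⟩⟩
    · exact ⟨R, hR, ⟨R.hx.le, le_rfl, R.hy.le, le_rfl⟩, Or.inr ⟨hu, rfl⟩⟩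
  refine le_iInf₂ fun g hg => le_iInf₂ fun h hh => le_iInf fun hne => ?_
  obtain ⟨A, hA⟩ := key g hg
  obtain ⟨B, hB⟩ := key h hh
  exact three_le_geodesicDist hA hB hne

/-- A discarded corridor is overlooked by a kept guard, by the kernel condition; every room carries
a kept guard or its corner guard. -/
theorem IsGuardSet.isVertexGuardSet {G : Finset (ℤ × ℤ)} (hG : S.IsGuardSet G) :
    P.IsVertexGuardSet G := by
  constructor
  · intro v hv
    simp only [vertices, List.mem_toFinset, List.mem_flatMap, List.mem_append]
    rcases (hG v).1 hv with ⟨C, hC, -, rfl⟩ | ⟨R, hR, -, rfl⟩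
    · exact ⟨C, Or.inr hC, guard_mem_corners C⟩
    · exact ⟨R, Or.inl hR, by simp [corners]⟩
  · intro p hp
    obtain ⟨R, hR, hpR⟩ := Set.mem_iUnion₂.1 hp
    rcases List.mem_append.1 hR with hR' | hR'
    · by_cases hu : S.Unguarded R
      · exact ⟨_, (hG _).2 (Or.inr ⟨R, hR', hu, rfl⟩), sees_of_mem hR
          (gridPoint_mem_toSet.2 ⟨R.hx.le, le_rfl, R.hy.le, le_rfl⟩) hpR⟩
      · unfold Unguarded at hu
        push Not at hu
        obtain ⟨C, hC, hCk, hCR⟩ := hu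
        exact ⟨_, (hG _).2 (Or.inl ⟨C, hC, hCk, rfl⟩),
          sees_of_mem hR (gridPoint_mem_toSet.2 hCR) hpR⟩
    · by_cases hk : S.kept R
      · exact ⟨_, (hG _).2 (Or.inl ⟨R, hR', hk, rfl⟩),
          sees_of_mem hR (gridPoint_mem_toSet.2 (contains_guard R)) hpR⟩
      · rw [S.kept_iff R hR'] at hk
        push Not at hk
        obtain ⟨D, hD, hDR, hDk⟩ := hk
        exact ⟨_, (hG _).2 (Or.inl ⟨D, hD, hDk, rfl⟩), sees_of_overlooksFrom hR' hD hDR hpR⟩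

end GuardPlan

end OfficeLikePolygon

/-! ### Total correctness and running time of programs -/

namespace RAM

/-- The program halts after at most `T` steps in a state with the property `Q`. -/
def Ends (A : Prog) (s : State) (T : ℕ) (Q : State → Prop) : Prop :=
  ∃ t s', Exec A s t s' ∧ t ≤ T ∧ Q s'

/-- Assignment to a register. -/
abbrev State.setReg (s : State) (r : ℕ) (v : ℤ) : State :=
  { s with regs := Function.update s.regs r v }

/-- Assignment to a memory cell. -/
abbrev State.setMem (s : State) (a v : ℤ) : State :=
  { s with mem := Function.update s.mem a v }

/-- Output of a number. -/
abbrev State.print (s : State) (v : ℤ) : State :=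
  { s with out := s.out ++ [v] }

section Rules

variable {A B : Prog} {s : State} {T T' : ℕ} {Q Q' : State → Prop}

theorem Ends.mono (h : Ends A s T Q) (hT : T ≤ T') (hQ : ∀ s', Q s' → Q' s') : Ends A s T' Q' := by
  obtain ⟨t, s', h1, h2, h3⟩ := h
  exact ⟨t, s', h1, h2.trans hT, hQ s' h3⟩

theorem Ends.skip (h : Q s) : Ends .skip s 1 Q := ⟨1, s, .skip s, le_rfl, h⟩

theorem Ends.assign {r : ℕ} {e : Expr} (h : Q (s.setReg r (e.eval s))) :
    Ends (.assign r e) s (e.cost + 1) Q := ⟨_, _, .assign s r e, le_rfl, h⟩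

theorem Ends.store {a e : Expr} (h : Q (s.setMem (a.eval s) (e.eval s))) :
    Ends (.store a e) s (a.cost + e.cost + 1) Q := ⟨_, _, .store s a e, le_rfl, h⟩

theorem Ends.write {e : Expr} (h : Q (s.print (e.eval s))) :
    Ends (.write e) s (e.cost + 1) Q := ⟨_, _, .write s e, le_rfl, h⟩

theorem Ends.seq (hA : Ends A s T Q') (hB : ∀ s', Q' s' → Ends B s' T' Q) :
    Ends (.seq A B) s (T + T') Q := by
  obtain ⟨t, s₁, h1, h2, h3⟩ := hA
  obtain ⟨t', s₂, h4, h5, h6⟩ := hB s₁ h3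
  exact ⟨_, s₂, .seq h1 h4, by omega, h6⟩

theorem Ends.ite {b : Test} (hA : b.Holds s → Ends A s T Q) (hB : ¬ b.Holds s → Ends B s T' Q) :
    Ends (.ite b A B) s (b.cost + (T + T') + 1) Q := by
  by_cases h : b.Holds s
  · obtain ⟨t, s₁, h1, h2, h3⟩ := hA h
    exact ⟨_, s₁, .ite_true h h1, by omega, h3⟩
  · obtain ⟨t, s₁, h1, h2, h3⟩ := hB h
    exact ⟨_, s₁, .ite_false h h1, by omega, h3⟩

/-- The loop in which the register `r` runs through the numbers below `n`. -/
def Prog.for (r : ℕ) (n : Expr) (A : Prog) : Prog :=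
  .seq (.assign r (.const 0))
    (.loop (.not (.le n (.reg r))) (.seq A (.assign r (.add (.reg r) (.const 1)))))

/-- The invariant refers to the loop head. The bound `V` replaces the true number of rounds, so that
running times depend on `V` alone. -/
theorem Ends.for {r : ℕ} {n : Expr} {N V : ℕ} (I : ℕ → State → Prop) (hV : N ≤ V)
    (h0 : I 0 (s.setReg r 0)) (hI : ∀ k s, I k s → s.regs r = k ∧ n.eval s = N)
    (hA : ∀ k < N, ∀ s, I k s →
      Ends A s T fun s' => s'.regs r = k ∧ I (k + 1) (s'.setReg r (k + 1 : ℕ))) :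
    Ends (.for r n A) s (V * (T + (n.cost + 8)) + (n.cost + 6)) (I N) := by
  -- Induction on the number `d` of rounds still to come.
  have key : ∀ d k, k + d = N → ∀ s, I k s → Ends (.loop (.not (.le n (.reg r)))
      (.seq A (.assign r (.add (.reg r) (.const 1))))) s (d * (T + (n.cost + 8)) + (n.cost + 4))
      (I N) := by
    intro d
    induction d with
    | zero =>
      rintro k rfl s hs
      obtain ⟨h1, h2⟩ := hI _ s hs
      refine ⟨_, s, .loop_done ?_, ?_, hs⟩
      · simp [Test.Holds, Expr.eval, h1, h2]
      · simp [Test.cost, Expr.cost]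
    | succ d ih =>
      intro k hk s hs
      obtain ⟨h1, h2⟩ := hI _ s hs
      obtain ⟨t, s₁, h3, h4, h5, h6⟩ := hA k (by omega) s hs
      obtain ⟨t', s₂, h7, h8, h9⟩ := ih (k + 1) (by omega) _ h6
      refine ⟨_, s₂, .loop_step ?_ (.seq h3 (.assign s₁ r _)) (?_ : Exec _ _ t' s₂), ?_, h9⟩
      · simp only [Test.Holds, Expr.eval, h1, h2]
        omega
      · simpa [Expr.eval, h5] using h7
      · simp only [Test.cost, Expr.cost]
        ring_nf at h8 ⊢
        omega
  obtain ⟨t, s', h1, h2, h3⟩ := key N 0 (by omega) _ h0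
  refine ⟨_, s', .seq (.assign s r _) h1, ?_, h3⟩
  have := Nat.mul_le_mul_right (T + (n.cost + 8)) hV
  simp only [Expr.cost]
  omega

/-- The search for a number `j` below `n` with a property; the register `f` is the answer. -/
def Prog.any (f j : ℕ) (n : Expr) (b : Test) : Prog :=
  .seq (.assign f (.const 0)) (.for j n (.ite b (.assign f (.const 1)) .skip))

/-- The running time of a search. -/
def anyTime (n : Expr) (b : Test) (V : ℕ) : ℕ :=
  2 + (V * (b.cost + 3 + 1 + (n.cost + 8)) + (n.cost + 6))

/-- Two states differ at most in the two given registers. -/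
structure SameBut (f j : ℕ) (s s' : State) : Prop where
  mem : s'.mem = s.mem
  out : s'.out = s.out
  regs : ∀ r, r ≠ f → r ≠ j → s'.regs r = s.regs r

open Classical in
theorem Ends.any {f j : ℕ} {n : Expr} {b : Test} {N V : ℕ} (hfj : f ≠ j) (hV : N ≤ V)
    (p : ℕ → Prop) (hn : ∀ s', SameBut f j s s' → n.eval s' = N)
    (hb : ∀ s', SameBut f j s s' → ∀ k < N, s'.regs j = k → (b.Holds s' ↔ p k))
    (hQ : ∀ s', SameBut f j s s' → s'.regs f = (if ∃ k < N, p k then 1 else 0) → Q s') :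
    Ends (.any f j n b) s (anyTime n b V) Q := by
  refine Ends.mono (T := anyTime n b V)
    (Ends.seq (T := 2) (Ends.assign rfl) fun s₁ hs₁ => Ends.for (fun k s' => SameBut f j s s' ∧
      s'.regs j = k ∧ s'.regs f = if ∃ l < k, p l then 1 else 0) hV ?_ ?_ ?_) le_rfl
    (fun s' h => hQ s' h.1 h.2.2)
  · subst hs₁
    refine ⟨⟨rfl, rfl, fun r h1 h2 => ?_⟩, ?_, ?_⟩ <;> simp [*, Expr.eval]
  · exact fun k s' h => ⟨h.2.1, hn s' h.1⟩
  · rintro k hk s' ⟨h1, h2, h3⟩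
    have hset : ∀ {s₂ : State}, SameBut f j s s₂ → ∀ v, SameBut f j s (s₂.setReg j v) :=
      fun h v => ⟨h.mem, h.out, fun r hf hj => by simp [hj, h.regs r hf hj]⟩
    have hsucc : (∃ l < k + 1, p l) ↔ (∃ l < k, p l) ∨ p k := by
      simp only [Nat.lt_succ_iff_lt_or_eq, or_and_right, exists_or, exists_eq_left]
    refine Ends.mono (Ends.ite (T := 2) (T' := 1) (fun h => Ends.assign ?_) fun h => Ends.skip ?_)
      (by omega) (fun _ h => h)
    · rw [hb s' h1 k hk h2] at h
      refine ⟨by simp [hfj.symm, h2], ⟨h1.mem, h1.out, fun r hf hj => ?_⟩, by simp, ?_⟩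
      · simp [hf, hj, h1.regs r hf hj]
      · simp only [hsucc, h, or_true, if_true, Function.update_of_ne hfj, Function.update_self,
          Expr.eval]
    · rw [hb s' h1 k hk h2] at h
      refine ⟨h2, hset h1 _, by simp, ?_⟩
      simp only [Function.update_of_ne hfj, h3, hsucc, h, or_false]

end Rules

/-! ### Kernels of acyclic relations -/

/-- The rank counts predecessors below `n`. It grows strictly by transitivity, and it is less than
`n` because no element precedes itself. -/
theorem exists_rank (n : ℕ) (lt : ℕ → ℕ → Prop) (hirr : ∀ i, ¬ lt i i)
    (htrans : ∀ i j k, lt i j → lt j k → lt i k) :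
    ∃ rank : ℕ → ℕ, (∀ i < n, rank i < n) ∧ ∀ j < n, ∀ i, lt j i → rank j < rank i := by
  classical
  refine ⟨fun i => ((Finset.range n).filter fun j => lt j i).card, fun i hi => ?_,
    fun j hj i hji => Finset.card_lt_card ?_⟩
  · conv_rhs => rw [← Finset.card_range n]
    exact Finset.card_lt_card (Finset.filter_ssubset.2 ⟨i, Finset.mem_range.2 hi, hirr i⟩)
  · refine ⟨fun k hk => ?_, fun h => ?_⟩
    · rw [Finset.mem_filter] at hk ⊢
      exact ⟨hk.1, htrans _ _ _ hk.2 hji⟩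
    · exact hirr j (Finset.mem_filter.1 (h (Finset.mem_filter.2 ⟨Finset.mem_range.2 hj, hji⟩))).2

/-- The set `σ` consists of the numbers below `n` that are not dominated by an element of `σ`. -/
def IsKernel (n : ℕ) (p : ℕ → ℕ → Prop) (σ : ℕ → Prop) : Prop :=
  ∀ i < n, σ i ↔ ∀ j < n, p j i → ¬ σ j

/-- The rank makes domination well-founded, so membership can be defined by recursion on the
dominating elements. -/
theorem exists_isKernel (n : ℕ) (p : ℕ → ℕ → Prop) (rank : ℕ → ℕ)
    (h : ∀ j < n, ∀ i < n, p j i → rank j < rank i) : ∃ σ, IsKernel n p σ := by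
  let r : ℕ → ℕ → Prop := fun j i => j < n ∧ i < n ∧ p j i
  have wf : WellFounded r :=
    Subrelation.wf (fun {j i} hji => h j hji.1 i hji.2.1 hji.2.2) (measure rank).wf
  refine ⟨wf.fix fun i σ => ∀ j (hj : r j i), ¬ σ j hj, fun i hi => ?_⟩
  rw [wf.fix_eq]
  exact ⟨fun H j hj hp => H j ⟨hj, hi, hp⟩, fun H j hj => H j hj.1 hj.2.2⟩

end RAM

/-! ### Working memory, and the computation of kernels -/

namespace RAM

/-- The address of the entry `i` of the array `f`. -/
def work (f i : ℕ) : ℤ := -((f : ℤ) + 1) - 8 * i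

/-- Eight arrays are interleaved on the negative addresses, disjoint from each other and from the
input. -/
theorem work_inj {f g i j : ℕ} (hf : f < 8) (hg : g < 8) :
    work f i = work g j ↔ f = g ∧ i = j := by
  unfold work
  omega

theorem work_neg (f i : ℕ) : work f i < 0 := by
  unfold work
  omega

/-- Twice an expression. -/
abbrev Expr.double (e : Expr) : Expr := .add e e

/-- The address of the entry of the array `f` with the index in the register `r`. -/
def Expr.workAddr (f r : ℕ) : Expr :=
  .sub (.const (-((f : ℤ) + 1))) (.double (.double (.double (.reg r))))

/-- The entry of the array `f` with the index in the register `r`. -/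
def Expr.entry (f r : ℕ) : Expr := .load (.workAddr f r)

theorem eval_workAddr {f r i : ℕ} {s : State} (h : s.regs r = i) :
    (Expr.workAddr f r).eval s = work f i := by
  simp only [Expr.workAddr, Expr.eval, work, h]
  ring

theorem eval_entry {f r i : ℕ} {s : State} (h : s.regs r = i) :
    (Expr.entry f r).eval s = s.mem (work f i) := by
  simp only [Expr.entry, Expr.eval, eval_workAddr h]

/-- Two states have the same output and the same memory outside of the array `f`. -/
structure SameOff (f : ℕ) (s s' : State) : Prop where
  out : s'.out = s.out
  mem : ∀ a, (∀ i, a ≠ work f i) → s'.mem a = s.mem a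

theorem SameOff.work {f g i : ℕ} {s s' : State} (h : SameOff f s s') (hf : f < 8) (hg : g < 8)
    (hgf : g ≠ f) : s'.mem (work g i) = s.mem (work g i) :=
  h.mem _ fun _ hj => hgf ((work_inj hg hf).1 hj).1

theorem SameOff.nonneg {f : ℕ} {s s' : State} (h : SameOff f s s') {a : ℤ} (ha : 0 ≤ a) :
    s'.mem a = s.mem a :=
  h.mem _ fun j hj => by have := work_neg f j; omega

/-- Repeated updates of the array `f`, until it describes the kernel of the relation that the test
`b` decides for the numbers in the registers 1 and 0. -/
def Prog.kernel (f : ℕ) (n : Expr) (b : Test) : Prog :=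
  .for 3 n (.for 0 n (.seq (.any 2 1 n (.and b (.eq (.entry f 1) (.const 1))))
    (.store (.workAddr f 0) (.sub (.const 1) (.reg 2)))))

/-- The running time of `Prog.kernel`. -/
def kernelTime (f : ℕ) (n : Expr) (b : Test) (V : ℕ) : ℕ :=
  V * (V * (anyTime n (.and b (.eq (.entry f 1) (.const 1))) V +
    ((Expr.workAddr f 0).cost + (Expr.sub (.const 1) (.reg 2)).cost + 1) + (n.cost + 8)) +
    (n.cost + 6) + (n.cost + 8)) + (n.cost + 6)

-- After `k` rounds all entries of rank less than `k` are correct, whatever the array contained at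
-- the start. Ranks are less than `K`, so `K` rounds suffice, and the program need not know the
-- ranks.
open Classical in
theorem Ends.kernel {f : ℕ} {n : Expr} {b : Test} {K V : ℕ} {s : State} {Q : State → Prop}
    (hf : f < 8) (hV : K ≤ V) {p : ℕ → ℕ → Prop} {σ : ℕ → Prop} (hσ : IsKernel K p σ)
    {rank : ℕ → ℕ} (hlt : ∀ i < K, rank i < K)
    (hp : ∀ j < K, ∀ i < K, p j i → rank j < rank i)
    (hn : ∀ s', SameOff f s s' → n.eval s' = K)
    (hb : ∀ s', SameOff f s s' → ∀ i < K, ∀ j < K, s'.regs 0 = i → s'.regs 1 = j →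
      (b.Holds s' ↔ p j i))
    (hQ : ∀ s', SameOff f s s' → (∀ i < K, s'.mem (work f i) = if σ i then 1 else 0) → Q s') :
    Ends (.kernel f n b) s (kernelTime f n b V) Q := by
  have hsame : ∀ {s₁ s₂ : State}, SameOff f s s₁ → s₂.out = s₁.out → s₂.mem = s₁.mem →
      SameOff f s s₂ := fun h h1 h2 => ⟨h1.trans h.out, fun a ha => by rw [h2, h.mem a ha]⟩
  refine Ends.mono (Ends.for (fun k s' => SameOff f s s' ∧ s'.regs 3 = k ∧
    ∀ i < K, rank i < k → s'.mem (work f i) = if σ i then 1 else 0) hV ?_ ?_ ?_) le_rfl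
    (fun s' h => hQ s' h.1 fun i hi => h.2.2 i hi (hlt i hi))
  · exact ⟨⟨rfl, fun _ _ => rfl⟩, by simp, by simp⟩
  · exact fun k s' h => ⟨h.2.1, hn s' h.1⟩
  · rintro k - s₁ ⟨h1, h2, h3⟩
    -- Updates are made in place: entries of rank `k` become correct when the sweep passes them, and
    -- rewriting an entry of smaller rank reproduces its value.
    refine Ends.mono (Ends.for (fun m s' => SameOff f s s' ∧ s'.regs 3 = k ∧ s'.regs 0 = m ∧
      ∀ i < K, (rank i < k ∨ rank i = k ∧ i < m) →
        s'.mem (work f i) = if σ i then 1 else 0) hV ?_ ?_ ?_) le_rfl ?_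
    · refine ⟨hsame h1 rfl rfl, ?_, by simp, ?_⟩
      · simpa using h2
      · intro i hi h
        exact h3 i hi (by omega)
    · exact fun m s' h => ⟨h.2.2.1, hn s' h.1⟩
    · rintro m hm s₂ ⟨h4, h5, h6, h7⟩
      refine Ends.seq (Ends.any (by norm_num) hV (fun j => p j m ∧ s₂.mem (work f j) = 1) ?_ ?_
        fun s' h => fun h' => (⟨h, h'⟩ : SameBut 2 1 s₂ s' ∧ _)) ?_
      · exact fun s' h => hn s' (hsame h4 h.out h.mem)
      · intro s' h j hj hj'
        simp only [Test.Holds, eval_entry hj', h.mem, Expr.eval]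
        rw [hb s' (hsame h4 h.out h.mem) m hm j hj
          ((h.regs 0 (by norm_num) (by norm_num)).trans h6) hj']
      · rintro s₃ ⟨h8, h9⟩
        have h10 : s₃.regs 0 = m := (h8.regs 0 (by norm_num) (by norm_num)).trans h6
        have h11 : s₃.regs 3 = k := (h8.regs 3 (by norm_num) (by norm_num)).trans h5
        refine Ends.store ?_
        rw [eval_workAddr h10]
        refine ⟨h10, ⟨?_, ?_⟩, by simpa using h11, by simp, ?_⟩
        · exact h8.out.trans h4.out
        · intro a ha
          simp [Function.update_of_ne (ha m), h8.mem, h4.mem a ha]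
        · intro i hi h
          by_cases him : i = m
          · subst him
            -- Dominating elements have smaller rank, so their entries are already correct.
            have hmark : ∀ j < K, p j i → (s₂.mem (work f j) = 1 ↔ σ j) := by
              intro j hj hji
              rw [h7 j hj (Or.inl (by have := hp j hj i hi hji; omega))]
              by_cases hs : σ j <;> simp [hs]
            have : (∃ j < K, p j i ∧ s₂.mem (work f j) = 1) ↔ ¬ σ i := by
              rw [hσ i hi]
              push Not
              exact exists_congr fun j => and_congr_right fun hj => and_congr_right fun hji =>
                hmark j hj hji
            simp only [Function.update_self, Expr.eval, h9, this]
            by_cases hs : σ i <;> simp [hs]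
          · have hne : work f i ≠ work f m := fun h => him ((work_inj hf hf).1 h).2
            simp only [Function.update_of_ne hne, h8.mem]
            exact h7 i hi (by omega)
    · rintro s' ⟨h4, h5, h6, h7⟩
      refine ⟨h5, hsame h4 rfl rfl, by simp, ?_⟩
      intro i hi h
      exact h7 i hi (by omega)

end RAM

open RAM

/-! ### Existence of guard plans; rectangles by their index -/

/-- The rectangle with a given index in a list. -/
def nthRect (l : List IntRect) (i : ℕ) : IntRect :=
  l.getD i ⟨0, 1, 0, 1, zero_lt_one, zero_lt_one⟩

theorem mem_iff_nthRect {l : List IntRect} {R : IntRect} :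
    R ∈ l ↔ ∃ i < l.length, nthRect l i = R := by
  rw [List.mem_iff_getElem]
  constructor
  · rintro ⟨i, hi, h⟩
    exact ⟨i, hi, by rw [nthRect, List.getD_eq_getElem _ _ hi, h]⟩
  · rintro ⟨i, hi, h⟩
    exact ⟨i, hi, by rw [← h, nthRect, List.getD_eq_getElem _ _ hi]⟩

theorem nthRect_mem {l : List IntRect} {i : ℕ} (hi : i < l.length) : nthRect l i ∈ l :=
  mem_iff_nthRect.2 ⟨i, hi, rfl⟩

theorem nodup_of_pairwise_disjoint {l : List IntRect}
    (hl : l.Pairwise fun A B => Disjoint A.toSet B.toSet) : l.Nodup :=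
  hl.imp fun {A B} h hAB => by
    have h' := sep_of_disjoint h
    have := A.hx; have := A.hy
    subst hAB
    simp only [IntRect.Sep] at h'
    omega

theorem nthRect_inj {l : List IntRect} (hl : l.Nodup) {i j : ℕ} (hi : i < l.length)
    (hj : j < l.length) (h : nthRect l i = nthRect l j) : i = j := by
  rw [nthRect, nthRect, List.getD_eq_getElem _ _ hi, List.getD_eq_getElem _ _ hj] at h
  exact (hl.getElem_inj_iff).1 h

namespace OfficeLikePolygon

variable (P : OfficeLikePolygon)

/-- The order in which the kernel of the relation `OverlooksFrom` can be determined. -/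
def Before (left : IntRect → Prop) (D C : IntRect) : Prop :=
  (P.normal C).y₁ < (P.normal D).y₁ ∨ (P.normal C).y₁ = (P.normal D).y₁ ∧
    ((¬ left D ∧ ¬ left C ∧ (P.normal D).x₁ < (P.normal C).x₁) ∨ (¬ left D ∧ left C) ∨
      (left D ∧ left C ∧ (P.normal C).x₁ < (P.normal D).x₁))

theorem not_before_self (left : IntRect → Prop) (C : IntRect) : ¬ P.Before left C C := by
  simp [Before]

variable {P}

theorem Before.trans {left : IntRect → Prop} {C D E : IntRect} (h₁ : P.Before left C D)
    (h₂ : P.Before left D E) : P.Before left C E := by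
  unfold Before at *
  by_cases hC : left C <;> by_cases hD : left D <;> by_cases hE : left E <;>
    simp only [hC, hD, hE, not_true_eq_false, not_false_eq_true, true_and, false_and, false_or,
      or_false, and_true, and_false] at h₁ h₂ ⊢ <;> omega

/-- Overlooking never goes upwards. At equal height the exception in `Overlooks` keeps a left-end
guard from overlooking the corridor of a right-end one; so right-end guards come first, from left to
right, then left-end guards, from right to left. -/
theorem OverlooksFrom.before {left : IntRect → Prop} {C D : IntRect}
    (h : P.OverlooksFrom left D C) : P.Before left D C := by
  obtain ⟨-, h⟩ := h
  unfold Before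
  have := (P.normal C).hx; have := (P.normal D).hx
  by_cases hC : left C <;> by_cases hD : left D <;>
    simp only [Overlooks, hC, hD, not_true_eq_false, not_false_eq_true, true_and, false_and,
      false_or, or_false, and_true, and_false] at h ⊢ <;> omega

/-- The kernels in the definition of a guard plan can be computed by iteration. -/
structure GuardPlan.Computable (S : P.GuardPlan) : Prop where
  left : IsKernel P.corridors.length
    (fun j i => P.StackedOn (nthRect P.corridors j) (nthRect P.corridors i))
    (fun i => S.left (nthRect P.corridors i))
  left_rank : ∃ rank : ℕ → ℕ, (∀ i < P.corridors.length, rank i < P.corridors.length) ∧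
    ∀ j < P.corridors.length, ∀ i < P.corridors.length,
      P.StackedOn (nthRect P.corridors j) (nthRect P.corridors i) → rank j < rank i
  kept : IsKernel P.corridors.length
    (fun j i => P.OverlooksFrom S.left (nthRect P.corridors j) (nthRect P.corridors i))
    (fun i => S.kept (nthRect P.corridors i))
  kept_rank : ∃ rank : ℕ → ℕ, (∀ i < P.corridors.length, rank i < P.corridors.length) ∧
    ∀ j < P.corridors.length, ∀ i < P.corridors.length,
      P.OverlooksFrom S.left (nthRect P.corridors j) (nthRect P.corridors i) → rank j < rank i

/-- Kernels on a list without repetitions. -/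
theorem exists_kernel_of_nodup {l : List IntRect} (hl : l.Nodup) {r : IntRect → IntRect → Prop}
    {rank : ℕ → ℕ} (h : ∀ j < l.length, ∀ i < l.length,
      r (nthRect l j) (nthRect l i) → rank j < rank i) :
    ∃ σ : IntRect → Prop, (∀ C ∈ l, σ C ↔ ∀ D ∈ l, r D C → ¬ σ D) ∧
      IsKernel l.length (fun j i => r (nthRect l j) (nthRect l i)) (fun i => σ (nthRect l i)) := by
  obtain ⟨τ, hτ⟩ := exists_isKernel l.length (fun j i => r (nthRect l j) (nthRect l i)) rank h
  let σ : IntRect → Prop := fun C => ∃ i < l.length, nthRect l i = C ∧ τ i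
  have hσ : ∀ i < l.length, σ (nthRect l i) ↔ τ i := fun i hi =>
    ⟨fun ⟨j, hj, h1, h2⟩ => nthRect_inj hl hj hi h1 ▸ h2, fun h => ⟨i, hi, rfl, h⟩⟩
  have key : IsKernel l.length (fun j i => r (nthRect l j) (nthRect l i))
      (fun i => σ (nthRect l i)) := by
    intro i hi
    refine (hσ i hi).trans ((hτ i hi).trans ?_)
    exact forall_congr' fun j => forall_congr' fun hj => by simp only [hσ j hj]
  refine ⟨σ, fun C hC => ?_, key⟩
  obtain ⟨i, hi, rfl⟩ := mem_iff_nthRect.1 hC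
  refine (key i hi).trans ?_
  constructor
  · intro H D hD
    obtain ⟨j, hj, rfl⟩ := mem_iff_nthRect.1 hD
    exact H j hj
  · exact fun H j hj => H _ (nthRect_mem hj)

variable (P)

/-- Stacking increases `y₁` of the normal form, which makes the first relation acyclic. The second
depends on the sides chosen, so its kernel comes after. -/
theorem exists_guardPlan : ∃ S : P.GuardPlan, S.Computable := by
  have hnodup := nodup_of_pairwise_disjoint P.corridors_disjoint
  obtain ⟨rank, h1, h2⟩ := exists_rank P.corridors.length
    (fun j i => (P.normal (nthRect P.corridors j)).y₁ < (P.normal (nthRect P.corridors i)).y₁)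
    (fun i => lt_irrefl _) (fun i j k => lt_trans)
  have h3 : ∀ j < P.corridors.length, ∀ i < P.corridors.length,
      P.StackedOn (nthRect P.corridors j) (nthRect P.corridors i) → rank j < rank i :=
    fun j hj i _ h => h2 j hj i (by
      have := h.2.2.2
      omega)
  obtain ⟨left, h4, h5⟩ := exists_kernel_of_nodup hnodup h3
  obtain ⟨rank', h1', h2'⟩ := exists_rank P.corridors.length
    (fun j i => P.Before left (nthRect P.corridors j) (nthRect P.corridors i))
    (fun i => P.not_before_self left _) (fun i j k => Before.trans)
  have h3' : ∀ j < P.corridors.length, ∀ i < P.corridors.length,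
      P.OverlooksFrom left (nthRect P.corridors j) (nthRect P.corridors i) → rank' j < rank' i :=
    fun j hj i _ h => h2' j hj i h.before
  obtain ⟨kept, h4', h5'⟩ := exists_kernel_of_nodup hnodup h3'
  exact ⟨⟨left, kept, h4, h4'⟩, ⟨h5, ⟨rank, h1, h3⟩, h5', ⟨rank', h1', h3'⟩⟩⟩

/-- There are at least as many vertices as pairwise disjoint rooms or corridors. -/
theorem length_le_card_vertices {l : List IntRect}
    (hl : l.Pairwise fun A B => Disjoint A.toSet B.toSet) (h : l ⊆ P.rooms ++ P.corridors) :
    l.length ≤ P.vertices.card := by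
  classical
  rw [← List.toFinset_card_of_nodup (nodup_of_pairwise_disjoint hl)]
  -- Disjoint rectangles have different lower left corners.
  refine Finset.card_le_card_of_injOn (fun R => (R.x₁, R.y₁)) ?_ ?_
  · intro R hR
    simp only [vertices, List.coe_toFinset, Set.mem_ofPred_eq, List.mem_flatMap] at hR ⊢
    exact ⟨R, h hR, by simp [corners]⟩
  · intro A hA B hB hAB
    simp only [List.coe_toFinset, Set.mem_ofPred_eq] at hA hB
    by_contra hne
    have := sep_of_pairwise_disjoint hl hA hB hne
    have := A.hx; have := A.hy; have := B.hx; have := B.hy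
    simp only [Prod.mk.injEq] at hAB
    simp only [IntRect.Sep] at *
    omega

end OfficeLikePolygon

/-! ### The program -/

theorem getD_flatMap_coords {l : List IntRect} {i : ℕ} (hi : i < l.length) :
    (l.flatMap coords).getD (4 * i) 0 = (nthRect l i).x₁ ∧
    (l.flatMap coords).getD (4 * i + 1) 0 = (nthRect l i).x₂ ∧
    (l.flatMap coords).getD (4 * i + 2) 0 = (nthRect l i).y₁ ∧
    (l.flatMap coords).getD (4 * i + 3) 0 = (nthRect l i).y₂ := by
  induction l generalizing i with
  | nil => simp at hi
  | cons R l ih =>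
    cases i with
    | zero => simp [coords, nthRect]
    | succ i =>
      have := ih (i := i) (by simpa using hi)
      simpa [coords, nthRect, Nat.mul_succ, Nat.add_right_comm _ 4] using this

namespace OfficeLikePolygon

variable (P : OfficeLikePolygon)

/-- The room with a given index. -/
abbrev room (i : ℕ) : IntRect := nthRect P.rooms i

/-- The corridor with a given index. -/
abbrev corridor (i : ℕ) : IntRect := nthRect P.corridors i

/-- The memory contains the input. -/
structure HasInput (m : ℤ → ℤ) : Prop where
  rooms_length : m 0 = P.rooms.length
  corridors_length : m 1 = P.corridors.length
  room : ∀ i < P.rooms.length, m (2 + 4 * i) = (P.room i).x₁ ∧ m (3 + 4 * i) = (P.room i).x₂ ∧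
    m (4 + 4 * i) = (P.room i).y₁ ∧ m (5 + 4 * i) = (P.room i).y₂
  corridor : ∀ i < P.corridors.length,
    m (2 + (4 * P.rooms.length + 4 * i)) = (P.corridor i).x₁ ∧
    m (3 + (4 * P.rooms.length + 4 * i)) = (P.corridor i).x₂ ∧
    m (4 + (4 * P.rooms.length + 4 * i)) = (P.corridor i).y₁ ∧
    m (5 + (4 * P.rooms.length + 4 * i)) = (P.corridor i).y₂

variable {P}

theorem HasInput.congr {m m' : ℤ → ℤ} (h : P.HasInput m) (hm : ∀ a, 0 ≤ a → m' a = m a) :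
    P.HasInput m' := by
  obtain ⟨h1, h2, h3, h4⟩ := h
  refine ⟨by rw [hm _ (by omega), h1], by rw [hm _ (by omega), h2], fun i hi => ?_,
    fun i hi => ?_⟩
  · rw [hm _ (by omega), hm _ (by omega), hm _ (by omega), hm _ (by omega)]
    exact h3 i hi
  · rw [hm _ (by omega), hm _ (by omega), hm _ (by omega), hm _ (by omega)]
    exact h4 i hi

theorem init_encode_apply (a : ℕ) :
    (State.init P.encode).mem (a + 2 : ℕ) =
      ((P.rooms ++ P.corridors).flatMap coords).getD a 0 := by
  have : (0 : ℤ) ≤ (a + 2 : ℕ) := by omega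
  simp only [State.init, this, if_true, Int.toNat_natCast, encode, List.getD_cons_succ]

theorem hasInput_init : P.HasInput (State.init P.encode).mem := by
  have key : ∀ i < (P.rooms ++ P.corridors).length, ∀ m : ℤ → ℤ,
      m = (State.init P.encode).mem →
      m (2 + 4 * i) = (nthRect (P.rooms ++ P.corridors) i).x₁ ∧
      m (3 + 4 * i) = (nthRect (P.rooms ++ P.corridors) i).x₂ ∧
      m (4 + 4 * i) = (nthRect (P.rooms ++ P.corridors) i).y₁ ∧
      m (5 + 4 * i) = (nthRect (P.rooms ++ P.corridors) i).y₂ := by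
    rintro i hi m rfl
    obtain ⟨h1, h2, h3, h4⟩ := getD_flatMap_coords hi
    rw [← init_encode_apply] at h1 h2 h3 h4
    rw [← h1, ← h2, ← h3, ← h4]
    push_cast
    refine ⟨?_, ?_, ?_, ?_⟩ <;> congr 1 <;> ring
  refine ⟨by simp [State.init, encode], by simp [State.init, encode], fun i hi => ?_,
    fun i hi => ?_⟩
  · have := key i (by simp; omega) _ rfl
    rwa [nthRect, List.getD_append _ _ _ _ hi] at this
  · have := key (P.rooms.length + i) (by simpa using hi) _ rfl
    rw [nthRect, List.getD_append_right _ _ _ _ (by omega), Nat.add_sub_cancel_left] at this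
    push_cast at this
    simp only [mul_add] at this
    exact this

end OfficeLikePolygon

namespace RAM

/-- The coordinate with number `f` of the room with the index in the register `r`. -/
def Expr.roomField (f r : ℕ) : Expr :=
  .load (.add (.const (f + 2)) (.double (.double (.reg r))))

/-- The coordinate with number `f` of the corridor with the index in the register `r`. -/
def Expr.corridorField (f r : ℕ) : Expr :=
  .load (.add (.const (f + 2))
    (.add (.double (.double (.load (.const 0)))) (.double (.double (.reg r)))))

theorem eval_roomField {P : OfficeLikePolygon} {s : State} (h : P.HasInput s.mem) {r i : ℕ}
    (hr : s.regs r = i) (hi : i < P.rooms.length) :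
    (Expr.roomField 0 r).eval s = (P.room i).x₁ ∧ (Expr.roomField 1 r).eval s = (P.room i).x₂ ∧
    (Expr.roomField 2 r).eval s = (P.room i).y₁ ∧
    (Expr.roomField 3 r).eval s = (P.room i).y₂ := by
  have h1 := h.room i hi
  have h2 : (i : ℤ) + i + (i + i) = 4 * i := by ring
  simp only [Expr.roomField, Expr.eval, hr, h2]
  exact h1

theorem eval_corridorField {P : OfficeLikePolygon} {s : State} (h : P.HasInput s.mem) {r i : ℕ}
    (hr : s.regs r = i) (hi : i < P.corridors.length) :
    (Expr.corridorField 0 r).eval s = (P.corridor i).x₁ ∧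
    (Expr.corridorField 1 r).eval s = (P.corridor i).x₂ ∧
    (Expr.corridorField 2 r).eval s = (P.corridor i).y₁ ∧
    (Expr.corridorField 3 r).eval s = (P.corridor i).y₂ := by
  have h1 := h.corridor i hi
  have h2 : ∀ i : ℤ, i + i + (i + i) = 4 * i := fun i => by ring
  simp only [Expr.corridorField, Expr.eval, hr, h2, h.rooms_length]
  exact h1

/-- The test `e₁ < e₂`. -/
abbrev Test.lt (e₁ e₂ : Expr) : Test := .not (.le e₂ e₁)

/-- The disjunction of two tests. -/
abbrev Test.or (b₁ b₂ : Test) : Test := .not (.and (.not b₁) (.not b₂))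

/-- The number of rooms. -/
abbrev Expr.numRooms : Expr := .load (.const 0)

/-- The number of corridors. -/
abbrev Expr.numCorridors : Expr := .load (.const 1)

/-- Four entries with the index in the register 0. -/
def Prog.store4 (e₀ e₁ e₂ e₃ : Expr) : Prog :=
  .seq (.store (.workAddr 0 0) e₀) (.seq (.store (.workAddr 1 0) e₁)
    (.seq (.store (.workAddr 2 0) e₂) (.store (.workAddr 3 0) e₃)))

/-- The running time of `Prog.store4`. -/
def store4Time (e₀ e₁ e₂ e₃ : Expr) : ℕ :=
  ((Expr.workAddr 0 0).cost + e₀.cost + 1) + (((Expr.workAddr 1 0).cost + e₁.cost + 1) +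
    (((Expr.workAddr 2 0).cost + e₂.cost + 1) + ((Expr.workAddr 3 0).cost + e₃.cost + 1)))

theorem Ends.seq_store {a e : Expr} {B : Prog} {s : State} {T : ℕ} {Q : State → Prop}
    (h : Ends B (s.setMem (a.eval s) (e.eval s)) T Q) :
    Ends (.seq (.store a e) B) s ((a.cost + e.cost + 1) + T) Q :=
  Ends.seq (Ends.store rfl) fun _ h' => h' ▸ h

/-- The expressions need only be stable under changes at negative addresses, since they read nothing
but the input. -/
theorem Ends.store4 {e₀ e₁ e₂ e₃ : Expr} {v₀ v₁ v₂ v₃ : ℤ} {s : State} {i : ℕ}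
    {Q : State → Prop} (hi : s.regs 0 = i)
    (he : ∀ s', s'.regs = s.regs → (∀ a, 0 ≤ a → s'.mem a = s.mem a) →
      e₀.eval s' = v₀ ∧ e₁.eval s' = v₁ ∧ e₂.eval s' = v₂ ∧ e₃.eval s' = v₃)
    (hQ : ∀ s', s'.regs = s.regs → s'.out = s.out →
      (∀ a, (∀ f < 4, a ≠ work f i) → s'.mem a = s.mem a) →
      s'.mem (work 0 i) = v₀ ∧ s'.mem (work 1 i) = v₁ ∧ s'.mem (work 2 i) = v₂ ∧
        s'.mem (work 3 i) = v₃ → Q s') :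
    Ends (.store4 e₀ e₁ e₂ e₃) s (store4Time e₀ e₁ e₂ e₃) Q := by
  have hne : ∀ {f : ℕ} {a : ℤ}, 0 ≤ a → a ≠ work f i := fun {f a} h h' => by
    have := work_neg f i
    omega
  refine Ends.seq_store ?_
  rw [eval_workAddr hi, (he s rfl fun _ _ => rfl).1]
  refine Ends.seq_store ?_
  rw [eval_workAddr (by exact hi), (he _ (by rfl) fun a ha => ?_).2.1]
  swap
  · simp [Function.update_of_ne (hne ha)]
  refine Ends.seq_store ?_
  rw [eval_workAddr (by exact hi), (he _ (by rfl) fun a ha => ?_).2.2.1]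
  swap
  · simp [Function.update_of_ne (hne ha)]
  refine Ends.store ?_
  rw [eval_workAddr (by exact hi), (he _ (by rfl) fun a ha => ?_).2.2.2]
  swap
  · simp [Function.update_of_ne (hne ha)]
  refine hQ _ rfl rfl (fun a ha => ?_) ?_
  · simp [Function.update_of_ne (ha _ _)]
  · simp [work_inj]

/-- The register 0 is the index of a corridor, the register 1 that of a room, and the left side of
the corridor lies in the right edge of the room. -/
def touches : Test :=
  .and (.eq (.roomField 1 1) (.corridorField 0 0))
    (.and (.lt (.roomField 2 1) (.corridorField 2 0))
      (.lt (.corridorField 3 0) (.roomField 3 1)))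

/-- Computes the directions and the normal forms of the corridors. -/
def normalize : Prog :=
  .for 0 .numCorridors (.seq (.any 2 1 .numRooms touches) (.ite (.eq (.reg 2) (.const 1))
    (.store4 (.const 1) (.corridorField 0 0) (.corridorField 1 0) (.corridorField 2 0))
    (.store4 (.const 0) (.corridorField 2 0) (.corridorField 3 0) (.corridorField 0 0))))

/-- The corridor with the index in the register 0 lies directly on top of the other one. -/
def isStacked : Test :=
  .and (.eq (.entry 0 1) (.entry 0 0)) (.and (.eq (.entry 1 1) (.entry 1 0))
    (.and (.eq (.entry 2 1) (.entry 2 0)) (.eq (.add (.entry 3 1) (.const 2)) (.entry 3 0))))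

/-- The corridor with the index in the register 1 overlooks the other one. -/
def overlooks : Test :=
  .and (.eq (.entry 0 1) (.entry 0 0))
    (.and (.or (.eq (.entry 3 1) (.entry 3 0)) (.eq (.entry 3 1) (.add (.entry 3 0) (.const 1))))
      (.or
        (.and (.eq (.entry 4 1) (.const 0))
          (.or (.eq (.entry 1 0) (.add (.entry 2 1) (.const 1)))
            (.eq (.entry 1 0) (.add (.entry 2 1) (.const 2)))))
        (.and (.eq (.entry 4 1) (.const 1))
          (.and (.or (.eq (.entry 1 1) (.add (.entry 2 0) (.const 1)))
              (.eq (.entry 1 1) (.add (.entry 2 0) (.const 2))))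
            (.not (.and (.eq (.entry 4 0) (.const 0)) (.eq (.entry 3 1) (.entry 3 0))))))))

/-- Computes the guard of the corridor with the index in the register 0. -/
def guardPosition : Prog :=
  .seq (.ite (.eq (.entry 4 0) (.const 1)) (.assign 4 (.entry 1 0)) (.assign 4 (.entry 2 0)))
    (.seq (.assign 5 (.entry 3 0))
      (.ite (.eq (.entry 0 0) (.const 1))
        (.seq (.store (.workAddr 6 0) (.reg 4)) (.store (.workAddr 7 0) (.reg 5)))
        (.seq (.store (.workAddr 6 0) (.reg 5)) (.store (.workAddr 7 0) (.reg 4)))))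

/-- Computes the guards of the corridors, and writes those that are kept. -/
def writeGuards : Prog :=
  .for 0 .numCorridors (.seq guardPosition
    (.ite (.eq (.entry 5 0) (.const 1)) (.seq (.write (.entry 6 0)) (.write (.entry 7 0))) .skip))

/-- The guard of the corridor with the index in the register 1 is kept, and stands on the room with
the index in the register 0. -/
def guards : Test :=
  .and (.eq (.entry 5 1) (.const 1))
    (.and (.and (.le (.roomField 0 0) (.entry 6 1)) (.le (.entry 6 1) (.roomField 1 0)))
      (.and (.le (.roomField 2 0) (.entry 7 1)) (.le (.entry 7 1) (.roomField 3 0))))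

/-- Writes the upper right corners of the rooms on which no guard stands. -/
def writeCorners : Prog :=
  .for 0 .numRooms (.seq (.any 2 1 .numCorridors guards) (.ite (.eq (.reg 2) (.const 1)) .skip
    (.seq (.write (.roomField 1 0)) (.write (.roomField 3 0)))))

/-- The program that computes a set of guards. -/
def guardProgram : Prog :=
  .seq normalize (.seq (.kernel 4 .numCorridors isStacked)
    (.seq (.kernel 5 .numCorridors overlooks) (.seq writeGuards writeCorners)))

end RAM

/-! ### Correctness of the program -/

namespace OfficeLikePolygon

variable {P : OfficeLikePolygon}

open Classical in
/-- The memory contains the input, and the directions and normal forms of the first `k`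
corridors. -/
structure Normalized (P : OfficeLikePolygon) (k : ℕ) (m : ℤ → ℤ) : Prop where
  input : P.HasInput m
  entries : ∀ i < k, m (work 0 i) = (if P.Hor (P.corridor i) then 1 else 0) ∧
    m (work 1 i) = (P.normal (P.corridor i)).x₁ ∧ m (work 2 i) = (P.normal (P.corridor i)).x₂ ∧
    m (work 3 i) = (P.normal (P.corridor i)).y₁

theorem Normalized.congr {k : ℕ} {m m' : ℤ → ℤ} (h : P.Normalized k m)
    (hm : ∀ a, 0 ≤ a → m' a = m a) (hm' : ∀ f < 4, ∀ i, m' (work f i) = m (work f i)) :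
    P.Normalized k m' := by
  refine ⟨h.input.congr hm, fun i hi => ?_⟩
  rw [hm' 0 (by omega), hm' 1 (by omega), hm' 2 (by omega), hm' 3 (by omega)]
  exact h.entries i hi

theorem Normalized.sameOff {k f : ℕ} {s s' : State} (h : P.Normalized k s.mem)
    (hs : SameOff f s s') (hf : 4 ≤ f) (hf' : f < 8) : P.Normalized k s'.mem :=
  h.congr (fun _ ha => hs.nonneg ha) fun g hg i => hs.work hf' (by omega) (by omega)

open Classical in
/-- The array `f` contains the truth values of a property of the corridors. -/
def HasArray (P : OfficeLikePolygon) (f : ℕ) (p : IntRect → Prop) (m : ℤ → ℤ) : Prop :=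
  ∀ i < P.corridors.length, m (work f i) = if p (P.corridor i) then 1 else 0

/-- The arrays 6 and 7 contain the guards of the first `k` corridors. -/
def HasGuards (P : OfficeLikePolygon) (left : IntRect → Prop) (k : ℕ) (m : ℤ → ℤ) : Prop :=
  ∀ i < k, m (work 6 i) = (P.guard left (P.corridor i)).1 ∧
    m (work 7 i) = (P.guard left (P.corridor i)).2

end OfficeLikePolygon

namespace RAM

open OfficeLikePolygon

variable {P : OfficeLikePolygon} {s : State} {V : ℕ}

theorem ite_one_zero_eq_one {p : Prop} [Decidable p] : (if p then (1 : ℤ) else 0) = 1 ↔ p := by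
  split_ifs <;> simp_all

theorem ite_one_zero_eq_zero {p : Prop} [Decidable p] :
    (if p then (1 : ℤ) else 0) = 0 ↔ ¬ p := by
  split_ifs <;> simp_all

theorem ite_one_zero_inj {p q : Prop} [Decidable p] [Decidable q] :
    (if p then (1 : ℤ) else 0) = (if q then 1 else 0) ↔ (p ↔ q) := by
  split_ifs <;> simp_all

theorem holds_touches (h : P.HasInput s.mem) {i j : ℕ} (hi : i < P.corridors.length)
    (hj : j < P.rooms.length) (h0 : s.regs 0 = i) (h1 : s.regs 1 = j) :
    touches.Holds s ↔ (P.corridor i).HasLeft (P.room j) := by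
  have h2 := eval_roomField h h1 hj
  have h3 := eval_corridorField h h0 hi
  simp only [touches, Test.Holds, h2, h3, not_le, HasLeft]

/-- The running time of `normalize`. -/
def normalizeTime (V : ℕ) : ℕ :=
  V * (anyTime .numRooms touches V +
    ((Test.eq (.reg 2) (.const 1)).cost +
      (store4Time (.const 1) (.corridorField 0 0) (.corridorField 1 0) (.corridorField 2 0) +
        store4Time (.const 0) (.corridorField 2 0) (.corridorField 3 0) (.corridorField 0 0)) +
      1) + (Expr.numCorridors.cost + 8)) + (Expr.numCorridors.cost + 6)

theorem ends_normalize (h : P.HasInput s.mem) (hR : P.rooms.length ≤ V)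
    (hK : P.corridors.length ≤ V) :
    Ends normalize s (normalizeTime V) fun s' =>
      P.Normalized P.corridors.length s'.mem ∧ s'.out = s.out := by
  refine Ends.mono (Ends.for (fun k s' => P.Normalized k s'.mem ∧ s'.out = s.out ∧
    s'.regs 0 = k) hK ⟨⟨h, by simp⟩, rfl, by simp⟩ ?_ ?_) le_rfl fun s' h => ⟨h.1, h.2.1⟩
  · exact fun k s' h => ⟨h.2.2, h.1.input.corridors_length⟩
  · rintro k hk s₁ ⟨h1, h2, h3⟩
    refine Ends.seq (Ends.any (by norm_num) hR
      (fun j => (P.corridor k).HasLeft (P.room j)) ?_ ?_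
      fun s' h => fun h' => (⟨h, h'⟩ : SameBut 2 1 s₁ s' ∧ _)) ?_
    · exact fun s' h => by
        simp only [Expr.eval, h.mem]
        exact h1.input.rooms_length
    · intro s' h j hj hj'
      exact holds_touches (h.mem ▸ h1.input) hk hj
        ((h.regs 0 (by norm_num) (by norm_num)).trans h3) hj'
    · rintro s₂ ⟨h4, h5⟩
      have h0 : s₂.regs 0 = k := (h4.regs 0 (by norm_num) (by norm_num)).trans h3
      have hin : P.HasInput s₂.mem := h4.mem ▸ h1.input
      -- By `hor_iff`, testing the left side against the rooms is enough to recognize the direction.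
      have hhor : (∃ j < P.rooms.length, (P.corridor k).HasLeft (P.room j)) ↔
          P.Hor (P.corridor k) := by
        rw [hor_iff (nthRect_mem hk)]
        constructor
        · rintro ⟨j, hj, h⟩
          exact ⟨_, nthRect_mem hj, h⟩
        · rintro ⟨A, hA, h⟩
          obtain ⟨j, hj, rfl⟩ := mem_iff_nthRect.1 hA
          exact ⟨j, hj, h⟩
      have hnew : ∀ s' : State, s'.regs = s₂.regs → s'.out = s₂.out →
          (∀ a, (∀ f < 4, a ≠ work f k) → s'.mem a = s₂.mem a) →
          (open Classical in s'.mem (work 0 k) = if P.Hor (P.corridor k) then 1 else 0) →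
          s'.mem (work 1 k) = (P.normal (P.corridor k)).x₁ →
          s'.mem (work 2 k) = (P.normal (P.corridor k)).x₂ →
          s'.mem (work 3 k) = (P.normal (P.corridor k)).y₁ →
          s'.regs 0 = k ∧ P.Normalized (k + 1) (s'.setReg 0 (k + 1 : ℕ)).mem ∧
            (s'.setReg 0 (k + 1 : ℕ)).out = s.out ∧
            (s'.setReg 0 (k + 1 : ℕ)).regs 0 = (k + 1 : ℕ) := by
        intro s' hr ho hm e0 e1 e2 e3
        refine ⟨by rw [hr, h0], ⟨hin.congr fun a ha => hm a fun f _ h => ?_, fun i hi => ?_⟩,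
          by rw [ho, h4.out, h2], by simp⟩
        · have := work_neg f k
          omega
        · by_cases hik : i = k
          · subst hik
            exact ⟨e0, e1, e2, e3⟩
          · have : ∀ f < 4, s'.mem (work f i) = s₁.mem (work f i) := fun f hf => by
              rw [hm _ fun g hg hfg => hik ((work_inj (by omega) (by omega)).1 hfg).2, h4.mem]
            simp only [this 0 (by omega), this 1 (by omega), this 2 (by omega), this 3 (by omega)]
            exact h1.entries i (by omega)
      refine Ends.ite (fun ht => ?_) fun ht => ?_ <;>
        simp only [Test.Holds, Expr.eval, h5, ite_one_zero_eq_one, hhor] at ht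
      · refine Ends.store4 h0 (fun s' hr hm => ?_) fun s' hr ho hm he =>
          hnew s' hr ho hm (by rw [he.1, if_pos ht]) he.2.1 he.2.2.1 he.2.2.2
        have := eval_corridorField (hin.congr hm) (hr ▸ h0 : s'.regs 0 = k) hk
        simp only [normal, ht, if_true]
        exact ⟨rfl, this.1, this.2.1, this.2.2.1⟩
      · refine Ends.store4 h0 (fun s' hr hm => ?_) fun s' hr ho hm he =>
          hnew s' hr ho hm (by rw [he.1, if_neg ht]) he.2.1 he.2.2.1 he.2.2.2
        have := eval_corridorField (hin.congr hm) (hr ▸ h0 : s'.regs 0 = k) hk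
        simp only [normal, ht, if_false]
        exact ⟨rfl, this.2.2.1, this.2.2.2, this.1⟩

theorem holds_isStacked (h : P.Normalized P.corridors.length s.mem) {i j : ℕ}
    (hi : i < P.corridors.length) (hj : j < P.corridors.length) (h0 : s.regs 0 = i)
    (h1 : s.regs 1 = j) : isStacked.Holds s ↔ P.StackedOn (P.corridor j) (P.corridor i) := by
  have h2 := h.entries i hi
  have h3 := h.entries j hj
  simp only [isStacked, Test.Holds, Expr.eval, eval_entry h0, eval_entry h1, h2, h3,
    ite_one_zero_inj, StackedOn, Stacked]

theorem holds_overlooks {left : IntRect → Prop} (h : P.Normalized P.corridors.length s.mem)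
    (h' : P.HasArray 4 left s.mem) {i j : ℕ}
    (hi : i < P.corridors.length) (hj : j < P.corridors.length) (h0 : s.regs 0 = i)
    (h1 : s.regs 1 = j) :
    overlooks.Holds s ↔ P.OverlooksFrom left (P.corridor j) (P.corridor i) := by
  have h2 := h.entries i hi
  have h3 := h.entries j hj
  simp only [overlooks, Test.Holds, Expr.eval, eval_entry h0, eval_entry h1, h2, h3,
    h' i hi, h' j hj, ite_one_zero_inj, ite_one_zero_eq_one, ite_one_zero_eq_zero, OverlooksFrom,
    Overlooks]
  tauto

/-- The guard is expressed by exactly the quantities that the arrays 0 to 4 hold. -/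
theorem guard_eq (left : IntRect → Prop) (C : IntRect) : open Classical in
    P.guard left C = if P.Hor C
      then (if left C then (P.normal C).x₁ else (P.normal C).x₂, (P.normal C).y₁)
      else ((P.normal C).y₁, if left C then (P.normal C).x₁ else (P.normal C).x₂) := by
  unfold OfficeLikePolygon.guard normal anchor
  split_ifs <;> rfl

/-- The running time of `guardPosition`. -/
def guardPositionTime : ℕ :=
  ((Test.eq (.entry 4 0) (.const 1)).cost +
    (((Expr.entry 1 0).cost + 1) + ((Expr.entry 2 0).cost + 1)) + 1) +
  (((Expr.entry 3 0).cost + 1) +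
  ((Test.eq (.entry 0 0) (.const 1)).cost +
    ((((Expr.workAddr 6 0).cost + (Expr.reg 4).cost + 1) +
      ((Expr.workAddr 7 0).cost + (Expr.reg 5).cost + 1)) +
    (((Expr.workAddr 6 0).cost + (Expr.reg 5).cost + 1) +
      ((Expr.workAddr 7 0).cost + (Expr.reg 4).cost + 1))) + 1))

theorem ends_guardPosition {left : IntRect → Prop}
    (h : P.Normalized P.corridors.length s.mem) (h' : P.HasArray 4 left s.mem) {i : ℕ}
    (hi : i < P.corridors.length) (h0 : s.regs 0 = i) :
    Ends guardPosition s guardPositionTime fun s' => s'.regs 0 = i ∧ s'.out = s.out ∧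
      (∀ a, a ≠ work 6 i → a ≠ work 7 i → s'.mem a = s.mem a) ∧
      s'.mem (work 6 i) = (P.guard left (P.corridor i)).1 ∧
      s'.mem (work 7 i) = (P.guard left (P.corridor i)).2 := by
  classical
  have h2 := h.entries i hi
  set C := P.corridor i
  refine Ends.seq (Q' := fun s' => s'.regs 0 = i ∧ s'.out = s.out ∧ s'.mem = s.mem ∧
    s'.regs 4 = if left C then (P.normal C).x₁ else (P.normal C).x₂) ?_ ?_
  · refine Ends.ite (fun ht => Ends.assign ?_) fun ht => Ends.assign ?_ <;>
      simp only [Test.Holds, Expr.eval, eval_entry h0, h' i hi, ite_one_zero_eq_one] at ht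
    · refine ⟨by simpa using h0, rfl, rfl, ?_⟩
      rw [if_pos ht]
      simp [eval_entry h0, h2]
    · refine ⟨by simpa using h0, rfl, rfl, ?_⟩
      rw [if_neg ht]
      simp [eval_entry h0, h2]
  rintro s₁ ⟨h3, h4, h5, h6⟩
  refine Ends.seq (Q' := fun s' => s'.regs 0 = i ∧ s'.out = s.out ∧ s'.mem = s.mem ∧
    s'.regs 4 = (if left C then (P.normal C).x₁ else (P.normal C).x₂) ∧
    s'.regs 5 = (P.normal C).y₁) (Ends.assign ⟨?_, h4, h5, ?_, ?_⟩) ?_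
  · simpa using h3
  · simpa using h6
  · simp [eval_entry h3, h5, h2]
  rintro s₂ ⟨h3, h4, h5, h6, h7⟩
  have h67 : work 6 i ≠ work 7 i := by simp [work_inj]
  refine Ends.ite (fun ht => Ends.seq_store (Ends.store ?_))
    fun ht => Ends.seq_store (Ends.store ?_) <;>
    simp only [Test.Holds, Expr.eval, eval_entry h3, h5, h2, ite_one_zero_eq_one] at ht
  all_goals
    rw [eval_workAddr h3, eval_workAddr (by exact h3)]
    refine ⟨h3, h4, fun a ha ha' => ?_, ?_, ?_⟩
    · simp only [Function.update_of_ne ha, Function.update_of_ne ha', h5]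
  · simp only [Function.update_of_ne h67, Function.update_self, Expr.eval, guard_eq, if_pos ht, h6]
  · simp only [Function.update_self, Expr.eval, guard_eq, if_pos ht, h7]
  · simp only [Function.update_of_ne h67, Function.update_self, Expr.eval, guard_eq, if_neg ht, h7]
  · simp only [Function.update_self, Expr.eval, guard_eq, if_neg ht, h6]

open Classical in
/-- The kept guards among the guards of the first `k` corridors. -/
noncomputable def keptGuards (S : P.GuardPlan) (k : ℕ) : List (ℤ × ℤ) :=
  ((List.range k).filter fun i => S.kept (P.corridor i)).map
    fun i => P.guard S.left (P.corridor i)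

open Classical in
/-- The upper right corners of the unguarded rooms among the first `k` rooms. -/
noncomputable def roomGuards (S : P.GuardPlan) (k : ℕ) : List (ℤ × ℤ) :=
  ((List.range k).filter fun i => S.Unguarded (P.room i)).map
    fun i => ((P.room i).x₂, (P.room i).y₂)

/-- The running time of `writeGuards`. -/
def writeGuardsTime (V : ℕ) : ℕ :=
  V * (guardPositionTime + ((Test.eq (.entry 5 0) (.const 1)).cost +
    (((Expr.entry 6 0).cost + 1) + ((Expr.entry 7 0).cost + 1) + 1) + 1) +
    (Expr.numCorridors.cost + 8)) + (Expr.numCorridors.cost + 6)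

theorem ends_writeGuards {S : P.GuardPlan} (h : P.Normalized P.corridors.length s.mem)
    (h₄ : P.HasArray 4 S.left s.mem) (h₅ : P.HasArray 5 S.kept s.mem) (hs : s.out = [])
    (hK : P.corridors.length ≤ V) :
    Ends writeGuards s (writeGuardsTime V) fun s' => P.HasInput s'.mem ∧
      P.HasArray 5 S.kept s'.mem ∧ P.HasGuards S.left P.corridors.length s'.mem ∧
      s'.out = encodePoints (keptGuards S P.corridors.length) := by
  refine Ends.mono (Ends.for (fun k s' => s'.regs 0 = k ∧
    (P.Normalized P.corridors.length s'.mem ∧ P.HasArray 4 S.left s'.mem ∧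
      P.HasArray 5 S.kept s'.mem ∧ P.HasGuards S.left k s'.mem) ∧
      s'.out = encodePoints (keptGuards S k)) hK ?_ ?_ ?_) le_rfl
    fun s' h => ⟨h.2.1.1.input, h.2.1.2.2.1, h.2.1.2.2.2, h.2.2⟩
  · refine ⟨by simp, ⟨h, h₄, h₅, fun i hi => absurd hi (by simp)⟩, ?_⟩
    simp [hs, keptGuards, encodePoints]
  · exact fun k s' h => ⟨h.1, h.2.1.1.input.corridors_length⟩
  · rintro k hk s₁ ⟨h0, ⟨h1, h2, h3, h4⟩, h5⟩
    refine Ends.seq (ends_guardPosition h1 h2 hk h0) ?_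
    rintro s₂ ⟨h6, h7, h8, h9, h10⟩
    have hold : ∀ f < 8, f ≠ 6 → f ≠ 7 → ∀ i, s₂.mem (work f i) = s₁.mem (work f i) :=
      fun f hf h6 h7 i => h8 _ (fun h => h6 ((work_inj hf (by norm_num)).1 h).1)
        (fun h => h7 ((work_inj hf (by norm_num)).1 h).1)
    have hmem : P.Normalized P.corridors.length s₂.mem ∧ P.HasArray 4 S.left s₂.mem ∧
        P.HasArray 5 S.kept s₂.mem ∧ P.HasGuards S.left (k + 1) s₂.mem := by
      refine ⟨h1.congr (fun a ha => h8 a ?_ ?_) fun f hf i =>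
        hold f (by omega) (by omega) (by omega) i, fun i hi => ?_, fun i hi => ?_, fun i hi => ?_⟩
      · have := work_neg 6 k
        omega
      · have := work_neg 7 k
        omega
      · rw [hold 4 (by norm_num) (by norm_num) (by norm_num), h2 i hi]
      · rw [hold 5 (by norm_num) (by norm_num) (by norm_num), h3 i hi]
      · by_cases hik : i = k
        · subst hik
          exact ⟨h9, h10⟩
        · rw [h8 _ (by simp [work_inj, hik]) (by simp [work_inj]),
            h8 _ (by simp [work_inj]) (by simp [work_inj, hik])]
          exact h4 i (by omega)
    refine Ends.ite (fun ht => ?_) fun ht => Ends.skip ?_ <;>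
      simp only [Test.Holds, Expr.eval, eval_entry h6, hmem.2.2.1 k hk,
        ite_one_zero_eq_one] at ht
    · refine Ends.seq (Ends.write rfl) fun s₃ h₃ => Ends.write ?_
      subst h₃
      refine ⟨h6, by simp, hmem, ?_⟩
      simp [eval_entry h6, eval_entry (s := s₂.print _) (by exact h6), h7, h5, h9, h10,
        keptGuards, List.range_succ, encodePoints, ht]
    · refine ⟨h6, by simp, hmem, ?_⟩
      simp [h7, h5, keptGuards, List.range_succ, ht]

theorem holds_guards {S : P.GuardPlan} (h : P.HasInput s.mem) (h₅ : P.HasArray 5 S.kept s.mem)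
    (h₆ : P.HasGuards S.left P.corridors.length s.mem) {i j : ℕ} (hi : i < P.rooms.length)
    (hj : j < P.corridors.length) (h0 : s.regs 0 = i) (h1 : s.regs 1 = j) :
    guards.Holds s ↔ S.kept (P.corridor j) ∧
      (P.room i).Contains (P.guard S.left (P.corridor j)) := by
  have h2 := eval_roomField h h0 hi
  simp only [guards, Test.Holds, Expr.eval, eval_entry h1, h2, h₅ j hj, h₆ j hj,
    ite_one_zero_eq_one, Contains, and_assoc]

/-- The running time of `writeCorners`. -/
def writeCornersTime (V : ℕ) : ℕ :=
  V * (anyTime .numCorridors guards V + ((Test.eq (.reg 2) (.const 1)).cost +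
    (1 + (((Expr.roomField 1 0).cost + 1) + ((Expr.roomField 3 0).cost + 1))) + 1) +
    (Expr.numRooms.cost + 8)) + (Expr.numRooms.cost + 6)

theorem ends_writeCorners {S : P.GuardPlan} (h : P.HasInput s.mem)
    (h₅ : P.HasArray 5 S.kept s.mem) (h₆ : P.HasGuards S.left P.corridors.length s.mem)
    {L : List (ℤ × ℤ)} (hs : s.out = encodePoints L) (hR : P.rooms.length ≤ V)
    (hK : P.corridors.length ≤ V) :
    Ends writeCorners s (writeCornersTime V) fun s' =>
      s'.out = encodePoints (L ++ roomGuards S P.rooms.length) := by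
  refine Ends.mono (Ends.for (fun k s' => s'.regs 0 = k ∧ s'.mem = s.mem ∧
      s'.out = encodePoints (L ++ roomGuards S k)) hR ?_ ?_ ?_) le_rfl fun s' h => h.2.2
  · refine ⟨by simp, rfl, ?_⟩
    simp [hs, roomGuards]
  · exact fun k s' h' => ⟨h'.1, by rw [← h.rooms_length, ← h'.2.1]; rfl⟩
  · rintro k hk s₁ ⟨h0, h1, h2⟩
    refine Ends.seq (Ends.any (by norm_num) hK (fun j => S.kept (P.corridor j) ∧
      (P.room k).Contains (P.guard S.left (P.corridor j))) ?_ ?_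
      fun s' h => fun h' => (⟨h, h'⟩ : SameBut 2 1 s₁ s' ∧ _)) ?_
    · exact fun s' h' => by rw [← h.corridors_length, ← h1, ← h'.mem]; rfl
    · intro s' h' j hj hj'
      have hm : s'.mem = s.mem := h'.mem.trans h1
      exact holds_guards (by rwa [hm]) (by rwa [hm]) (by rwa [hm]) hk hj
        ((h'.regs 0 (by norm_num) (by norm_num)).trans h0) hj'
    · rintro s₂ ⟨h4, h5⟩
      have h6 : s₂.regs 0 = k := (h4.regs 0 (by norm_num) (by norm_num)).trans h0
      have h7 : s₂.mem = s.mem := h4.mem.trans h1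
      have hun : (∃ j < P.corridors.length, S.kept (P.corridor j) ∧
          (P.room k).Contains (P.guard S.left (P.corridor j))) ↔ ¬ S.Unguarded (P.room k) := by
        unfold GuardPlan.Unguarded
        push Not
        constructor
        · rintro ⟨j, hj, h⟩
          exact ⟨_, nthRect_mem hj, h⟩
        · rintro ⟨A, hA, h⟩
          obtain ⟨j, hj, rfl⟩ := mem_iff_nthRect.1 hA
          exact ⟨j, hj, h⟩
      refine Ends.ite (fun ht => Ends.skip ?_) fun ht => ?_ <;>
        simp only [Test.Holds, Expr.eval, h5, ite_one_zero_eq_one, hun, not_not] at ht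
      · refine ⟨h6, by simp, h7, ?_⟩
        simp [h4.out, h2, roomGuards, List.range_succ, ht]
      · refine Ends.seq (Ends.write rfl) fun s₃ h₃ => Ends.write ?_
        subst h₃
        have e1 := eval_roomField (h7 ▸ h : P.HasInput s₂.mem) h6 hk
        have e2 := eval_roomField (s := s₂.print ((Expr.roomField 1 0).eval s₂))
          (h7 ▸ h : P.HasInput s₂.mem) h6 hk
        refine ⟨h6, by simp, h7, ?_⟩
        rw [e1.2.1] at e2 ⊢
        simp [e2.2.2.2, h4.out, h2, roomGuards, List.range_succ, ht, encodePoints]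

/-- The running time of `guardProgram`. -/
def guardProgramTime (V : ℕ) : ℕ :=
  normalizeTime V + (kernelTime 4 .numCorridors isStacked V +
    (kernelTime 5 .numCorridors overlooks V + (writeGuardsTime V + writeCornersTime V)))

theorem ends_guardProgram {S : P.GuardPlan} (hS : S.Computable) (hR : P.rooms.length ≤ V)
    (hK : P.corridors.length ≤ V) :
    Ends guardProgram (State.init P.encode) (guardProgramTime V) fun s' => s'.out =
      encodePoints (keptGuards S P.corridors.length ++ roomGuards S P.rooms.length) := by
  refine Ends.seq (ends_normalize hasInput_init hR hK) ?_
  rintro s₁ ⟨h1, h2⟩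
  obtain ⟨rank, hlt, hrank⟩ := hS.left_rank
  refine Ends.seq (Q' := fun s' => P.Normalized P.corridors.length s'.mem ∧
    P.HasArray 4 S.left s'.mem ∧ s'.out = []) (Ends.kernel (by norm_num) hK hS.left hlt hrank
    ?_ ?_ ?_) ?_
  · exact fun s' h => (h.nonneg (a := 1) (by norm_num)).trans h1.input.corridors_length
  · exact fun s' h i hi j hj h0 h1' =>
      holds_isStacked (h1.sameOff h (by norm_num) (by norm_num)) hi hj h0 h1'
  · exact fun s' h h' => ⟨h1.sameOff h (by norm_num) (by norm_num), h', h.out.trans h2⟩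
  rintro s₂ ⟨h3, h4, h5⟩
  obtain ⟨rank', hlt', hrank'⟩ := hS.kept_rank
  have harr : ∀ {s'}, SameOff 5 s₂ s' → P.HasArray 4 S.left s'.mem := fun h i hi => by
    rw [h.work (by norm_num) (by norm_num) (by norm_num), h4 i hi]
  refine Ends.seq (Q' := fun s' => P.Normalized P.corridors.length s'.mem ∧
    P.HasArray 4 S.left s'.mem ∧ P.HasArray 5 S.kept s'.mem ∧ s'.out = [])
    (Ends.kernel (by norm_num) hK hS.kept hlt' hrank' ?_ ?_ ?_) ?_
  · exact fun s' h => (h.nonneg (a := 1) (by norm_num)).trans h3.input.corridors_length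
  · exact fun s' h i hi j hj h0 h1' =>
      holds_overlooks (h3.sameOff h (by norm_num) (by norm_num)) (harr h) hi hj h0 h1'
  · exact fun s' h h' =>
      ⟨h3.sameOff h (by norm_num) (by norm_num), harr h, h', h.out.trans h5⟩
  rintro s₃ ⟨h6, h7, h8, h9⟩
  refine Ends.seq (ends_writeGuards h6 h7 h8 h9 hK) ?_
  rintro s₄ ⟨h10, h11, h12, h13⟩
  exact ends_writeCorners h10 h11 h12 h13 hR hK

theorem isGuardSet_toFinset (S : P.GuardPlan) : S.IsGuardSet
    (keptGuards S P.corridors.length ++ roomGuards S P.rooms.length).toFinset := by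
  intro v
  simp only [List.mem_toFinset, List.mem_append, keptGuards, roomGuards, List.mem_map,
    List.mem_filter, List.mem_range, decide_eq_true_eq]
  refine or_congr ?_ ?_
  · constructor
    · rintro ⟨i, ⟨hi, hk⟩, rfl⟩
      exact ⟨_, nthRect_mem hi, hk, rfl⟩
    · rintro ⟨C, hC, hk, rfl⟩
      obtain ⟨i, hi, rfl⟩ := mem_iff_nthRect.1 hC
      exact ⟨i, ⟨hi, hk⟩, rfl⟩
  · constructor
    · rintro ⟨i, ⟨hi, hk⟩, rfl⟩
      exact ⟨_, nthRect_mem hi, hk, rfl⟩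
    · rintro ⟨C, hC, hk, rfl⟩
      obtain ⟨i, hi, rfl⟩ := mem_iff_nthRect.1 hC
      exact ⟨i, ⟨hi, hk⟩, rfl⟩

/-! ### The running time is polynomial -/

/-- A function with polynomial values. -/
def IsPoly (f : ℕ → ℕ) : Prop := ∃ p : Polynomial ℕ, ∀ V, f V = p.eval V

theorem IsPoly.const (c : ℕ) : IsPoly fun _ => c := ⟨.C c, by simp⟩

theorem IsPoly.id : IsPoly fun V => V := ⟨.X, by simp⟩

theorem IsPoly.add {f g : ℕ → ℕ} (hf : IsPoly f) (hg : IsPoly g) : IsPoly fun V => f V + g V := by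
  obtain ⟨p, hp⟩ := hf
  obtain ⟨q, hq⟩ := hg
  exact ⟨p + q, fun V => by simp [hp, hq]⟩

theorem IsPoly.loop {f : ℕ → ℕ} (hf : IsPoly f) (c c' : ℕ) :
    IsPoly fun V => V * (f V + c) + c' := by
  obtain ⟨p, hp⟩ := hf
  exact ⟨.X * (p + .C c) + .C c', fun V => by simp [hp]⟩

theorem isPoly_anyTime (n : Expr) (b : Test) : IsPoly (anyTime n b) :=
  (IsPoly.const 2).add ((IsPoly.const _).loop _ _)

theorem isPoly_kernelTime (f : ℕ) (n : Expr) (b : Test) : IsPoly (kernelTime f n b) :=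
  (((isPoly_anyTime _ _).add (IsPoly.const _)).loop _ _).loop _ _

theorem isPoly_guardProgramTime : IsPoly guardProgramTime :=
  (((isPoly_anyTime _ _).add (IsPoly.const _)).loop _ _).add
    ((isPoly_kernelTime _ _ _).add ((isPoly_kernelTime _ _ _).add
      ((((IsPoly.const _).add (IsPoly.const _)).loop _ _).add
        (((isPoly_anyTime _ _).add (IsPoly.const _)).loop _ _))))

end RAM

/-! ### A polygon in which no vertex guard set has dispersion distance more than three -/

/-- The path with a vertical and then a horizontal segment. -/
noncomputable def cornerPath (p q : ℝ × ℝ) : Path p q where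
  toFun t := (p.1 + (q.1 - p.1) * max 0 (2 * (t : ℝ) - 1), p.2 + (q.2 - p.2) * min 1 (2 * (t : ℝ)))
  continuous_toFun := by fun_prop
  source' := by ext <;> norm_num
  target' := by ext <;> norm_num

/-- Both coordinates are monotone along the path, so its increments are those of the monotone real
function `φ`, whose variation is its total increase. -/
theorem l1Length_cornerPath_le (p q : ℝ × ℝ) :
    l1Length (cornerPath p q) ≤ ENNReal.ofReal (planeDist p q) := by
  let φ : unitInterval → ℝ := fun t =>
    |q.1 - p.1| * max 0 (2 * (t : ℝ) - 1) + |q.2 - p.2| * min 1 (2 * (t : ℝ))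
  have ha : ∀ {s t : unitInterval}, s ≤ t → max 0 (2 * (s : ℝ) - 1) ≤ max 0 (2 * (t : ℝ) - 1) :=
    fun {s t} h => max_le_max le_rfl (by have : (s : ℝ) ≤ t := h; linarith)
  have hb : ∀ {s t : unitInterval}, s ≤ t → min 1 (2 * (s : ℝ)) ≤ min 1 (2 * (t : ℝ)) :=
    fun {s t} h => min_le_min le_rfl (by have : (s : ℝ) ≤ t := h; linarith)
  have hφ : Monotone φ := fun s t h => by
    have := mul_le_mul_of_nonneg_left (ha h) (abs_nonneg (q.1 - p.1))
    have := mul_le_mul_of_nonneg_left (hb h) (abs_nonneg (q.2 - p.2))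
    simp only [φ]
    linarith
  have hdist : ∀ s t : unitInterval, s ≤ t →
      planeDist (cornerPath p q t) (cornerPath p q s) = |φ t - φ s| := by
    intro s t h
    rw [abs_of_nonneg (sub_nonneg.2 (hφ h))]
    simp only [planeDist, cornerPath, Path.coe_mk_mk, add_sub_add_left_eq_sub, ← mul_sub, abs_mul,
      abs_of_nonneg (sub_nonneg.2 (ha h)), abs_of_nonneg (sub_nonneg.2 (hb h)), φ]
    ring
  have htotal : eVariationOn φ Set.univ ≤ ENNReal.ofReal (planeDist p q) := by
    have h1 := (hφ.monotoneOn Set.univ).eVariationOn_eq (Set.mem_univ 0) (Set.mem_univ 1)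
    have h2 : Set.univ ∩ Set.Icc (0 : unitInterval) 1 = Set.univ := by
      rw [Set.univ_inter]
      exact Set.eq_univ_of_forall fun t => ⟨unitInterval.nonneg', unitInterval.le_one'⟩
    rw [h2] at h1
    rw [h1]
    refine ENNReal.ofReal_le_ofReal (le_of_eq ?_)
    rw [planeDist_comm]
    norm_num [φ, planeDist]
  refine le_trans (iSup_le fun ⟨n, u, hu, hmem⟩ => ?_) htotal
  refine le_trans (le_of_eq (Finset.sum_congr rfl fun i _ => ?_)) (eVariationOn.sum_le hu hmem)
  rw [edist_toLp_one, hdist _ _ (hu i.le_succ), edist_dist, Real.dist_eq]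

theorem cornerPath_mem {S : Set (ℝ × ℝ)} {p q : ℝ × ℝ}
    (h₁ : ∀ y ∈ Set.uIcc p.2 q.2, (p.1, y) ∈ S) (h₂ : ∀ x ∈ Set.uIcc p.1 q.1, (x, q.2) ∈ S)
    (t : unitInterval) : cornerPath p q t ∈ S := by
  have key : ∀ a b s : ℝ, 0 ≤ s → s ≤ 1 → a + (b - a) * s ∈ Set.uIcc a b := by
    intro a b s h0 h1
    rw [Set.mem_uIcc]
    rcases le_total a b with h | h
    · exact Or.inl ⟨by nlinarith, by nlinarith⟩
    · exact Or.inr ⟨by nlinarith, by nlinarith⟩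
  have h0 := t.2.1
  have h1 := t.2.2
  rcases le_total (2 * (t : ℝ)) 1 with h | h
  · have : cornerPath p q t = (p.1, p.2 + (q.2 - p.2) * (2 * (t : ℝ))) := by
      simp [cornerPath, min_eq_right h, max_eq_left (sub_nonpos.2 h)]
    rw [this]
    exact h₁ _ (key _ _ _ (by linarith) h)
  · have : cornerPath p q t = (p.1 + (q.1 - p.1) * (2 * (t : ℝ) - 1), q.2) := by
      simp [cornerPath, min_eq_left h, max_eq_right (sub_nonneg.2 h)]
    rw [this]
    exact h₂ _ (key _ _ _ (by linarith) (by linarith))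

theorem geodesicDist_le_planeDist {S : Set (ℝ × ℝ)} {p q : ℝ × ℝ}
    (h₁ : ∀ y ∈ Set.uIcc p.2 q.2, (p.1, y) ∈ S) (h₂ : ∀ x ∈ Set.uIcc p.1 q.1, (x, q.2) ∈ S) :
    geodesicDist S p q ≤ ENNReal.ofReal (planeDist p q) :=
  (iInf₂_le (cornerPath p q) (cornerPath_mem h₁ h₂)).trans (l1Length_cornerPath_le p q)

theorem IntRect.isConnected_toSet (R : IntRect) : IsConnected R.toSet :=
  ⟨⟨gridPoint (R.x₁, R.y₁), gridPoint_mem_toSet.2 ⟨le_rfl, R.hx.le, le_rfl, R.hy.le⟩⟩,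
    (convex_Icc _ _).isPreconnected⟩

theorem IntRect.disjoint_of_sep {A B : IntRect} (h : A.Sep B) : Disjoint A.toSet B.toSet :=
  Set.disjoint_left.2 fun _ hp => not_mem_of_sep h hp

/-- Two rooms, linked by three parallel corridors that form a ladder of unit squares. -/
def ladder : OfficeLikePolygon where
  rooms := [⟨0, 1, 0, 7, by norm_num, by norm_num⟩, ⟨2, 3, 0, 7, by norm_num, by norm_num⟩]
  corridors := [⟨1, 2, 1, 2, by norm_num, by norm_num⟩, ⟨1, 2, 3, 4, by norm_num, by norm_num⟩,
    ⟨1, 2, 5, 6, by norm_num, by norm_num⟩]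
  rooms_disjoint := by
    simp only [List.pairwise_cons, List.mem_singleton, forall_eq, List.not_mem_nil,
      false_imp_iff, implies_true, List.Pairwise.nil, and_true]
    exact disjoint_of_sep (by norm_num [IntRect.Sep])
  corridors_disjoint := by
    simp only [List.pairwise_cons, List.mem_cons, forall_eq_or_imp, List.not_mem_nil,
      false_imp_iff, implies_true, List.Pairwise.nil, and_true]
    refine ⟨⟨?_, ?_⟩, ?_⟩ <;> exact disjoint_of_sep (by norm_num [IntRect.Sep])
  corridors_link := by
    intro C hC
    refine ⟨_, List.mem_cons_self, _, List.mem_cons_of_mem _ List.mem_cons_self, Or.inl ?_, ?_⟩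
    · simp only [List.mem_cons, List.not_mem_nil, or_false] at hC
      rcases hC with rfl | rfl | rfl <;> norm_num [LinksHorizontally]
    · intro R hR h1 h2
      simp only [List.mem_cons, List.not_mem_nil, or_false] at hR
      exact absurd hR (by tauto)
  connected := by
    have h : ∀ {A : Set (ℝ × ℝ)} {R : IntRect} (v : ℤ × ℤ), gridPoint v ∈ A → R.Contains v →
        IsConnected A → IsConnected (A ∪ R.toSet) := fun v h1 h2 hA =>
      hA.union ⟨_, h1, gridPoint_mem_toSet.2 h2⟩ (isConnected_toSet _)
    have hmem : ∀ {R : IntRect} {v : ℤ × ℤ}, R.Contains v → gridPoint v ∈ R.toSet := fun h =>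
      gridPoint_mem_toSet.2 h
    let A : IntRect := ⟨0, 1, 0, 7, by norm_num, by norm_num⟩
    let B : IntRect := ⟨2, 3, 0, 7, by norm_num, by norm_num⟩
    let C : IntRect := ⟨1, 2, 1, 2, by norm_num, by norm_num⟩
    let D : IntRect := ⟨1, 2, 3, 4, by norm_num, by norm_num⟩
    let E : IntRect := ⟨1, 2, 5, 6, by norm_num, by norm_num⟩
    have key : IsConnected ((((A.toSet ∪ C.toSet) ∪ B.toSet) ∪ D.toSet) ∪ E.toSet) := by
      refine h (1, 5) (Or.inl (Or.inl (Or.inl (hmem (by norm_num [Contains, A])))))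
        (by norm_num [Contains, E])
        (h (1, 3) (Or.inl (Or.inl (hmem (by norm_num [Contains, A])))) (by norm_num [Contains, D])
        (h (2, 1) (Or.inr (hmem (by norm_num [Contains, C]))) (by norm_num [Contains, B])
        (h (1, 1) (hmem (by norm_num [Contains, A])) (by norm_num [Contains, C])
          (isConnected_toSet _))))
    convert key using 1
    ext p
    simp only [List.cons_append, List.nil_append, Set.mem_iUnion, List.mem_cons,
      List.not_mem_nil, or_false, exists_prop, exists_eq_or_imp, exists_eq_left, Set.mem_union,
      A, B, C, D, E]
    tauto

theorem mem_ladder_region {p : ℝ × ℝ} : p ∈ ladder.region ↔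
    ((0 ≤ p.1 ∧ p.1 ≤ 1 ∨ 2 ≤ p.1 ∧ p.1 ≤ 3) ∧ 0 ≤ p.2 ∧ p.2 ≤ 7) ∨
    (1 ≤ p.1 ∧ p.1 ≤ 2) ∧
      (1 ≤ p.2 ∧ p.2 ≤ 2 ∨ 3 ≤ p.2 ∧ p.2 ≤ 4 ∨ 5 ≤ p.2 ∧ p.2 ≤ 6) := by
  simp only [OfficeLikePolygon.region, ladder, List.cons_append, List.nil_append, Set.mem_iUnion,
    List.mem_cons, List.not_mem_nil, or_false, exists_prop, exists_eq_or_imp, exists_eq_left,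
    mem_toSet]
  push_cast
  tauto

/-- A vertex that sees the center of a corridor of the ladder is a corner of this corridor. -/
theorem ladder_corner_of_sees {g : ℤ × ℤ} (hg : g ∈ ladder.vertices) {k : ℤ}
    (hk : k = 1 ∨ k = 3 ∨ k = 5) (h : ladder.Sees (gridPoint g) (3 / 2, k + 1 / 2)) :
    (g.1 = 1 ∨ g.1 = 2) ∧ (g.2 = k ∨ g.2 = k + 1) := by
  have hv : (g.1 = 1 ∨ g.1 = 2) ∨ g.2 = 0 ∨ g.2 = 7 := by
    obtain ⟨x, y⟩ := g
    simp [OfficeLikePolygon.vertices, ladder, corners] at hg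
    omega
  -- The spanned rectangle contains the vertical segment from the center to the height of `g`. On
  -- the line `x = 3 / 2` the region consists of corridors only.
  have hmem : ∀ y : ℝ, y ∈ Set.uIcc (g.2 : ℝ) (k + 1 / 2) → ((3 / 2 : ℝ), y) ∈ ladder.region :=
    fun y hy => h ⟨⟨inf_le_right, hy.1⟩, ⟨le_sup_right, hy.2⟩⟩
  -- A lower vertex would put the height `k - 1 / 2`, beneath the corridor, on this segment;
  -- likewise `k + 3 / 2` for a higher one.
  have h1 : k ≤ g.2 := by
    by_contra! hlt
    have hlt' : (g.2 : ℝ) + 1 ≤ k := by exact_mod_cast hlt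
    have := mem_ladder_region.1 (hmem (k - 1 / 2) (Set.mem_uIcc.2 (Or.inl ⟨by linarith,
      by linarith⟩)))
    rcases hk with rfl | rfl | rfl <;> norm_num at this
  have h2 : g.2 ≤ k + 1 := by
    by_contra! hlt
    have hlt' : (k : ℝ) + 2 ≤ g.2 := by exact_mod_cast (by omega : k + 2 ≤ g.2)
    have := mem_ladder_region.1 (hmem (k + 3 / 2) (Set.mem_uIcc.2 (Or.inr ⟨by linarith,
      by linarith⟩)))
    rcases hk with rfl | rfl | rfl <;> norm_num at this
  omega

theorem ladder_dispersion_le {G : Finset (ℤ × ℤ)} (hG : ladder.IsVertexGuardSet G) :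
    ladder.dispersion G ≤ 3 := by
  have key : ∀ k : ℤ, k = 1 ∨ k = 3 ∨ k = 5 →
      ∃ g ∈ G, (g.1 = 1 ∨ g.1 = 2) ∧ (g.2 = k ∨ g.2 = k + 1) := by
    intro k hk
    obtain ⟨g, hg, hsees⟩ := hG.2 (3 / 2, k + 1 / 2) (by
      rw [mem_ladder_region]
      rcases hk with rfl | rfl | rfl <;> norm_num)
    exact ⟨g, hg, ladder_corner_of_sees (hG.1 hg) hk hsees⟩
  -- The connecting path follows a room wall to the height of `h`, then a corridor edge: every
  -- integer height from 1 to 6 is one of a corridor edge.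
  have hdist : ∀ g ∈ G, ∀ h ∈ G, g ≠ h → (g.1 = 1 ∨ g.1 = 2) → (h.1 = 1 ∨ h.1 = 2) →
      1 ≤ g.2 → g.2 ≤ 6 → 1 ≤ h.2 → h.2 ≤ 6 → gridDist g h ≤ 3 → ladder.dispersion G ≤ 3 := by
    intro g hg h hh hne hg1 hh1 hg2 hg3 hh2 hh3 hd
    refine (iInf₂_le g hg).trans ((iInf₂_le h hh).trans ((iInf_le _ hne).trans ?_))
    have h3 : ENNReal.ofReal (planeDist (gridPoint g) (gridPoint h)) ≤ 3 := by
      rw [planeDist_gridPoint, ENNReal.ofReal_natCast]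
      exact_mod_cast hd
    refine (geodesicDist_le_planeDist ?_ ?_).trans h3
    · intro y hy
      rw [mem_ladder_region]
      rify at hg1 hg2 hg3 hh2 hh3
      simp only [gridPoint] at hy ⊢
      have hy' : 0 ≤ y ∧ y ≤ 7 := by
        rcases Set.mem_uIcc.1 hy with h | h <;> constructor <;> linarith
      rcases hg1 with h | h <;> rw [h] <;> norm_num [hy'.1, hy'.2]
    · intro x hx
      rw [mem_ladder_region]
      simp only [gridPoint] at hx ⊢
      have hx' : 1 ≤ x ∧ x ≤ 2 := by
        rify at hg1 hh1
        rcases Set.mem_uIcc.1 hx with h | h <;> constructor <;>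
          rcases hg1 with h1 | h1 <;> rcases hh1 with h2 | h2 <;> linarith
      refine Or.inr ⟨hx', ?_⟩
      have : (1 ≤ h.2 ∧ h.2 ≤ 2) ∨ (3 ≤ h.2 ∧ h.2 ≤ 4) ∨ (5 ≤ h.2 ∧ h.2 ≤ 6) := by omega
      exact_mod_cast this
  obtain ⟨g₁, hg₁, h₁, h₁'⟩ := key 1 (by norm_num)
  obtain ⟨g₂, hg₂, h₂, h₂'⟩ := key 3 (by norm_num)
  obtain ⟨g₃, hg₃, h₃, h₃'⟩ := key 5 (by norm_num)
  have hne₁ : g₁ ≠ g₂ := fun h => by rw [h] at h₁'; omega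
  have hne₂ : g₂ ≠ g₃ := fun h => by rw [h] at h₂'; omega
  -- A distance of four between the first two requires the heights 1 and 4; the third guard is then
  -- at most two units higher than the second.
  have : gridDist g₁ g₂ ≤ 3 ∨ gridDist g₂ g₃ ≤ 3 := by
    simp only [gridDist]
    omega
  rcases this with h | h
  · exact hdist g₁ hg₁ g₂ hg₂ hne₁ h₁ h₂ (by omega) (by omega) (by omega) (by omega) h
  · exact hdist g₂ hg₂ g₃ hg₃ hne₂ h₂ h₃ (by omega) (by omega) (by omega) (by omega) h

theorem exists_program : ∃ (A : RAM.Prog) (p : Polynomial ℕ), ∀ P : OfficeLikePolygon,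
    ∃ (t : ℕ) (s : RAM.State) (L : List (ℤ × ℤ)),
      RAM.Exec A (RAM.State.init P.encode) t s ∧
      t ≤ p.eval P.vertices.card ∧
      s.out = encodePoints L ∧
      P.IsVertexGuardSet L.toFinset ∧ 3 ≤ P.dispersion L.toFinset := by
  obtain ⟨p, hp⟩ := isPoly_guardProgramTime
  refine ⟨guardProgram, p, fun P => ?_⟩
  obtain ⟨S, hS⟩ := P.exists_guardPlan
  obtain ⟨t, s, h1, h2, h3⟩ := ends_guardProgram hS
    (P.length_le_card_vertices P.rooms_disjoint (List.subset_append_left _ _))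
    (P.length_le_card_vertices P.corridors_disjoint (List.subset_append_right _ _))
  exact ⟨t, s, _, h1, hp _ ▸ h2, h3, (isGuardSet_toFinset S).isVertexGuardSet,
    (isGuardSet_toFinset S).three_le_dispersion⟩

theorem mainTheorem4 :
    -- every polygon has a vertex guard set with dispersion distance at least 3
    (∀ P : OfficeLikePolygon, ∃ G : Finset (ℤ × ℤ),
      P.IsVertexGuardSet G ∧ 3 ≤ P.dispersion G) ∧
    -- one program computes such guard sets in time polynomial in the number of vertices
    (∃ (A : RAM.Prog) (p : Polynomial ℕ), ∀ P : OfficeLikePolygon,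
      ∃ (t : ℕ) (s : RAM.State) (L : List (ℤ × ℤ)),
        RAM.Exec A (RAM.State.init P.encode) t s ∧
        t ≤ p.eval P.vertices.card ∧
        s.out = encodePoints L ∧
        P.IsVertexGuardSet L.toFinset ∧ 3 ≤ P.dispersion L.toFinset) ∧
    -- the bound 3 is sometimes optimal
    (∃ P : OfficeLikePolygon, ∀ G : Finset (ℤ × ℤ),
      P.IsVertexGuardSet G → P.dispersion G ≤ 3) := by
  refine ⟨fun P => ?_, exists_program, ladder, fun G => ladder_dispersion_le⟩
  obtain ⟨A, p, h⟩ := exists_program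
  obtain ⟨_, _, L, -, -, -, h⟩ := h P
  exact ⟨L.toFinset, h⟩
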